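/- Let $G_1,G_2$ be weighted undirected graphs on the same vertex set $[n]$, $n\ge 1$, with non-negative edge weights (self-loops allowed), weighted adjacency matrices $\tilde A_1,\tilde A_2$ and a common diagonal degree matrix $D$, $D(v,v)=\sum_{v'}\tilde A_1(v,v')=\sum_{v'}\tilde A_2(v,v')$. Let $A(G_i)=D^{-1/2}\tilde A_iD^{-1/2}$, and let $s$ be the spectral density of $A(G_1)-A(G_2)$, that is, the uniform distribution on its $n$ eigenvalues (with multiplicity). (At a vertex of degree $0$, a random walk stays where it is, and the entry of $D^{-1/2}$ is taken to be $0$.) For $j\ge 1$ and $x\in\{0,1\}^j$, a call to the oracle $\mathcal O(G_1,G_2,j,x)$ returns the trajectory $(v_0,\dots,v_j)$ of a random walk of length $j$ whose starting vertex $v_0$ is uniformly random and whose $i$-th step follows the transition matrix $D^{-1}\tilde A_1$ if $x_i=1$ and $D^{-1}\tilde A_2$ if $x_i=0$; different calls are independent. Consider the following algorithm with parameters $k\in\mathbb Z_{+}$ and $\theta,\delta>0$. For each $j\in\{1,\dots,k\}$ and each $x\in\{0,1\}^j$, make $\lceil\frac12\theta^{-2}j4^j\ln(2k/\delta)\rceil$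 calls to $\mathcal O(G_1,G_2,j,x)$, and let $\hat p_{j,x}$ be the fraction of the returned trajectories with $v_0=v_j$. Put $$\hat p_j=\sum_{x\in\{0,1\}^j}(-1)^{|\{i\,:\,x_i=0\}|}\,\hat p_{j,x}.$$ Output a probability distribution $p$ on $[-2,2]$ whose first $k$ moments match $\hat p_1,\dots,\hat p_k$ as well as possible up to a slack of $\theta$, i.e. such that $$\max_{1\le j\le k}\Big|\int x^j\,dp-\hat p_j\Big|\le \max_{1\le j\le k}\Big|\int x^j\,dq-\hat p_j\Big|+\theta$$ for every probability distribution $q$ on $[-2,2]$ (for instance, any $p$ whose first $k$ moments equal $\hat p_1,\dots,\hat p_k$, if there is one). Theorem. There is an absolute constant $C_0>0$ such that for every constant $C\ge C_0$ there is a constant $K>0$, depending only on $C$, with the following properties. Let $0<\epsilon<1$, $k=\lceil 4C/\epsilon\rceil$, $\theta=\epsilon/3^{2k+2}$ and $\delta=0.1$. The algorithm makes at most $2^{K/\epsilon}$ oracle calls in total, each for a walk of length at most $K/\epsilon$. For all $n\ge1$ and all $G_1,G_2$ as above, a distribution $p$ as required in the last step always exists. Moreover, with probability at least $0.9$ over the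 answers of the oracle, $\big|\hat p_j-\int x^j\,ds\big|\le\theta$ for all $j\in\{1,\dots,k\}$, and every such $p$ satisfies $W_1(p,s)\le\epsilon$, where $W_1$ denotes the Wasserstein-1 distance. -/

import Mathlib

open MeasureTheory
open scoped ENNReal

noncomputable section

/-- An undirected graph on the vertex set `{0, …, n-1}` with non-negative edge weights, given by its
weighted adjacency matrix (weight `0` means that there is no edge; self-loops are allowed). -/
structure WeightedGraph (n : ℕ) where
  adj : Matrix (Fin n) (Fin n) ℝ
  symm : ∀ u v, adj u v = adj v u
  nonneg : ∀ u v, 0 ≤ adj u v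

namespace WeightedGraph

variable {n : ℕ}

/-- The weighted degree of a vertex. -/
def degree (G : WeightedGraph n) (u : Fin n) : ℝ := ∑ v, G.adj u v

lemma degree_nonneg (G : WeightedGraph n) (u : Fin n) : 0 ≤ G.degree u :=
  Finset.sum_nonneg fun v _ => G.nonneg u v

/-- The matrix `D^{-1/2}` (with entry `0` at vertices of degree `0`). -/
def invSqrtDegree (G : WeightedGraph n) : Matrix (Fin n) (Fin n) ℝ :=
  Matrix.diagonal fun u => (Real.sqrt (G.degree u))⁻¹

/-- The normalized adjacency matrix `D^{-1/2} Ã D^{-1/2}`. -/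
def normalizedAdj (G : WeightedGraph n) : Matrix (Fin n) (Fin n) ℝ :=
  G.invSqrtDegree * G.adj * G.invSqrtDegree

lemma normalizedAdj_isHermitian (G : WeightedGraph n) : G.normalizedAdj.IsHermitian := by
  ext u v
  simp only [normalizedAdj, invSqrtDegree, Matrix.conjTranspose_apply, Matrix.mul_diagonal,
    Matrix.diagonal_mul, star_trivial]
  rw [G.symm v u]
  ring

lemma sum_step_eq_one (G : WeightedGraph n) (u : Fin n) (h : 0 < G.degree u) :
    ∑ v, ENNReal.ofReal (G.adj u v / G.degree u) = 1 := by
  rw [← ENNReal.ofReal_sum_of_nonneg fun v _ => div_nonneg (G.nonneg u v) h.le,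
    ← Finset.sum_div, ← ENNReal.ofReal_one]
  exact congrArg _ (div_self h.ne')

open Classical in
/-- One step of the edge-weighted random walk from `u`: move to `v` with probability
`(D⁻¹ Ã) u v`. A walk at a vertex of degree `0` stays there. -/
def step (G : WeightedGraph n) (u : Fin n) : PMF (Fin n) :=
  if h : 0 < G.degree u then
    PMF.ofFintype (fun v => ENNReal.ofReal (G.adj u v / G.degree u)) (G.sum_step_eq_one u h)
  else PMF.pure u

end WeightedGraph

/-- The spectral density of a real symmetric matrix: the uniform distribution on its eigenvalues,
counted with multiplicity. -/
def spectralDensity {n : ℕ} {M : Matrix (Fin n) (Fin n) ℝ} (hM : M.IsHermitian) : Measure ℝ :=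
  (n : ℝ≥0∞)⁻¹ • ∑ i, Measure.dirac (hM.eigenvalues i)

/-- The spectral density of the difference `A(G₁) - A(G₂)` of the normalized adjacency matrices. -/
def diffSpectralDensity {n : ℕ} (G₁ G₂ : WeightedGraph n) : Measure ℝ :=
  spectralDensity (G₁.normalizedAdj_isHermitian.sub G₂.normalizedAdj_isHermitian)

/-- The Wasserstein-1 distance of two distributions on the real line: the infimum of the transport
cost over all couplings. -/
def wasserstein1 (μ ν : Measure ℝ) : ℝ≥0∞ :=
  ⨅ (γ : Measure (ℝ × ℝ)) (_ : γ.map Prod.fst = μ ∧ γ.map Prod.snd = ν),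
    ∫⁻ z, ENNReal.ofReal |z.1 - z.2| ∂γ

/-- The `j`-th raw moment. -/
def rawMoment (μ : Measure ℝ) (j : ℕ) : ℝ := ∫ x, x ^ j ∂μ

/-- The alternating random-walk oracle: the random trajectory of a walk of length `j` that starts at
a uniformly random vertex and whose `i`-th step is a random-walk step in `G₁` if `x i = true` and in
`G₂` if `x i = false`. -/
def walkOracle {n : ℕ} [NeZero n] (G₁ G₂ : WeightedGraph n) :
    (j : ℕ) → (Fin j → Bool) → PMF (Fin (j + 1) → Fin n)
  | 0, _ => (PMF.uniformOfFintype (Fin n)).map fun v _ => v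
  | j + 1, x =>
    (walkOracle G₁ G₂ j (fun i => x i.castSucc)).bind fun t =>
      ((if x (Fin.last j) then G₁ else G₂).step (t (Fin.last j))).map fun v =>
        Fin.snoc (α := fun _ => Fin n) t v

namespace DiffSpectrum

/-- The number `⌈θ⁻² j 4ʲ log (2k/δ) / 2⌉` of samples that are drawn for each pattern of length
`j`. -/
def numSamples (k : ℕ) (θ δ : ℝ) (j : ℕ) : ℕ :=
  ⌈(1 / 2) * (θ ^ 2)⁻¹ * j * 4 ^ j * Real.log (2 * k / δ)⌉₊

/-- The oracle calls of the algorithm: for each length `j + 1 ∈ {1, …, k}` and each pattern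
`x ∈ {0,1}^(j+1)`, there are `numSamples k θ δ (j + 1)` calls. -/
abbrev Call (k : ℕ) (θ δ : ℝ) : Type :=
  Σ j : Fin k, (Fin (j + 1) → Bool) × Fin (numSamples k θ δ (j + 1))

/-- The length of the walk that is requested by a call. -/
abbrev Call.length {k : ℕ} {θ δ : ℝ} (c : Call k θ δ) : ℕ := c.1 + 1

/-- The pattern of graphs that is requested by a call. -/
abbrev Call.pattern {k : ℕ} {θ δ : ℝ} (c : Call k θ δ) : Fin c.length → Bool := c.2.1

/-- The answers to all oracle calls: this is all that the algorithm sees. -/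
abbrev Transcript (n k : ℕ) (θ δ : ℝ) : Type :=
  (c : Call k θ δ) → (Fin (c.length + 1) → Fin n)

/-- The distribution of the transcript: the answers to the calls are independent. -/
def transcriptLaw {n : ℕ} [NeZero n] (G₁ G₂ : WeightedGraph n) (k : ℕ) (θ δ : ℝ) :
    Measure (Transcript n k θ δ) :=
  Measure.pi fun c => (walkOracle G₁ G₂ c.length c.pattern).toMeasure

/-- The fraction of the sampled trajectories with pattern `x` that start and end at the same
vertex. -/
def returnFraction {n k : ℕ} {θ δ : ℝ} (ω : Transcript n k θ δ) (j : Fin k)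
    (x : Fin (j + 1) → Bool) : ℝ :=
  (∑ i : Fin (numSamples k θ δ (j + 1)),
    if ω ⟨j, x, i⟩ 0 = ω ⟨j, x, i⟩ (Fin.last _) then (1 : ℝ) else 0) /
      numSamples k θ δ (j + 1)

/-- The sign `(-1)^(number of steps in the second graph)` of a pattern. -/
def sign {j : ℕ} (x : Fin j → Bool) : ℝ := ∏ i, if x i then (1 : ℝ) else -1

/-- The estimate of the moment of order `j + 1`. -/
def momentEstimate {n k : ℕ} {θ δ : ℝ} (ω : Transcript n k θ δ) (j : Fin k) : ℝ :=
  ∑ x : Fin (j + 1) → Bool, sign x * returnFraction ω j x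

/-- The probability distributions on `[-2, 2]`. -/
def IsCandidate (p : Measure ℝ) : Prop :=
  IsProbabilityMeasure p ∧ p (Set.Icc (-2) 2)ᶜ = 0

/-- The largest deviation of the moments of order `1, …, k` of `p` from the values `a`. -/
def momentError {k : ℕ} (a : Fin k → ℝ) (p : Measure ℝ) : ℝ :=
  ‖fun j : Fin k => rawMoment p (j + 1) - a j‖

/-- The possible outputs of the moment-matching step for the estimates `a`: the distributions on
`[-2, 2]` whose first `k` moments match `a` as well as possible, up to a slack of `θ`. This includes
all the distributions with first `k` moments equal to `a`, if there are any. -/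
def IsMomentMatch {k : ℕ} (θ : ℝ) (a : Fin k → ℝ) (p : Measure ℝ) : Prop :=
  IsCandidate p ∧ ∀ q, IsCandidate q → momentError a p ≤ momentError a q + θ

end DiffSpectrum

end

/-! Two facts carry the proof: distributions on [-2, 2] with almost equal first k moments are close
in W₁, and the moments of s are signed sums of return probabilities, which sampling estimates.

For the first, W₁(p, s) is at most ∫ f dp - ∫ f ds for one explicit 1-Lipschitz f
(`wasserstein1_le_integral_potential`). By Jackson's theorem (`exists_chebyshev_approx`), f is
within 3/q on [-2, 2] of a combination of rescaled Chebyshev polynomials of degree below 4q with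
bounded coefficients. By the three-term recursion, a moment error η grows at most to 2 * 2^k * η on
each such polynomial. Hence W₁ ≤ 6/q + 4 k² 2^k η (`wasserstein1_le_of_moments`). With q about k/4
the first term is O(1/k), and θ = ε/3^(2k+2) makes the second negligible, because 9^k beats k² 2^k ≤
8^k.

For the second, the j-th moment of s is tr((A₁ - A₂)^j)/n. With R = D^(-1/2) and E = Ã₁ - Ã₂, A₁ -
A₂ = R E R, while the transition matrices satisfy T₁ - T₂ = R (R E), so cyclicity of the trace gives
tr((T₁ - T₂)^j)/n. Expanding this noncommutative power gives one signed product for each pattern,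
and its trace over n is a return probability (`sum_sign_mul_integral_return`). Hoeffding's
inequality and a union bound over the moments make all estimates θ-accurate with probability at
least 1 - δ. Then s itself competes in the moment matching, so each output has moments within 3θ of
those of s. -/

/-! ### Jackson's theorem via a positive trigonometric kernel -/

namespace JacksonKernel

open Finset Real

/-- The averages of the nonconstant trigonometric monomials over equidistant points vanish. -/
lemma sum_cos_equidistant (N : ℕ) (hN : 0 < N) (a : ℤ) (ha : ¬ (N : ℤ) ∣ a) (α : ℝ) :
    ∑ r ∈ range N, cos (α + a * (2 * π * r / N)) = 0 := by
  set ζ : ℂ := Complex.exp (2 * π * Complex.I / N) with hζ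
  have hp : IsPrimitiveRoot ζ N := Complex.isPrimitiveRoot_exp N hN.ne'
  have hne : ζ ^ a ≠ 1 := fun h => ha ((hp.zpow_eq_one_iff_dvd a).1 h)
  have hpow : (ζ ^ a) ^ N = 1 := by
    rw [← zpow_natCast, ← zpow_mul, mul_comm, zpow_mul, zpow_natCast, hp.pow_eq_one, one_zpow]
  have hsum : ∑ r ∈ range N, (ζ ^ a) ^ r = 0 := by
    have h := mul_neg_geom_sum (ζ ^ a) N
    rw [hpow, sub_self] at h
    exact (mul_eq_zero.1 h).resolve_left (sub_ne_zero.2 hne.symm)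
  have hterm : ∀ r : ℕ, cos (α + a * (2 * π * r / N))
      = (Complex.exp (α * Complex.I) * (ζ ^ a) ^ r).re := by
    intro r
    rw [hζ, ← Complex.exp_int_mul, ← Complex.exp_nat_mul, ← Complex.exp_add]
    rw [← Complex.exp_ofReal_mul_I_re]
    congr 2
    push_cast
    ring
  rw [sum_congr rfl fun r _ => hterm r, ← Complex.re_sum, ← mul_sum, hsum, mul_zero,
    Complex.zero_re]

/-- The squared modulus of the trigonometric sum with coefficients `c`. -/
noncomputable def kernel (c : ℕ → ℝ) (M : ℕ) (t : ℝ) : ℝ :=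
  ∑ l ∈ range M, ∑ l' ∈ range M, c l * c l' * cos (((l : ℤ) - l' : ℤ) * t)

lemma kernel_nonneg (c : ℕ → ℝ) (M : ℕ) (t : ℝ) : 0 ≤ kernel c M t := by
  have h : kernel c M t
      = (∑ l ∈ range M, c l * cos (l * t)) ^ 2 + (∑ l ∈ range M, c l * sin (l * t)) ^ 2 := by
    rw [sq, sq, sum_mul_sum, sum_mul_sum, ← sum_add_distrib]
    refine sum_congr rfl fun l _ => ?_
    rw [← sum_add_distrib]
    refine sum_congr rfl fun l' _ => ?_
    push_cast
    rw [sub_mul, cos_sub]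
    ring
  rw [h]
  positivity

/-! ### Discrete averages of the kernel -/

section Average

variable {c : ℕ → ℝ} {M N : ℕ} {t : ℕ → ℝ}

/-- The hypothesis `ht` lets the sum over the points replace an integral over the circle, exactly up
to frequency M. Only the diagonal terms l = l' survive. -/
lemma sum_kernel
    (ht : ∀ a : ℤ, a ≠ 0 → |a| ≤ M → ∑ r ∈ range N, cos (a * t r) = 0) :
    ∑ r ∈ range N, kernel c M (t r) = N * ∑ l ∈ range M, c l ^ 2 := by
  unfold kernel
  rw [sum_comm, mul_sum]
  refine sum_congr rfl fun l hl => ?_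
  rw [sum_comm, sum_eq_single_of_mem l hl]
  · simp [sq]
  · intro l' hl' hne
    rw [← mul_sum, ht _ (by omega), mul_zero]
    rw [mem_range] at hl hl'
    rw [abs_le]
    omega

/-- Multiplication by cos t shifts each frequency l - l' by ±1, with weight 1/2, so only the
neighbours l' = l ± 1 survive. The largest frequency that occurs is M. -/
lemma sum_kernel_mul_cos (hcM : c M = 0)
    (ht : ∀ a : ℤ, a ≠ 0 → |a| ≤ M → ∑ r ∈ range N, cos (a * t r) = 0) :
    ∑ r ∈ range N, kernel c M (t r) * cos (t r) = N * ∑ l ∈ range M, c l * c (l + 1) := by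
  have ht' : ∀ a : ℤ, |a| ≤ M → ∑ r ∈ range N, cos (a * t r) = if a = 0 then (N : ℝ) else 0 := by
    intro a ha
    split_ifs with h
    · simp [h]
    · exact ht a h ha
  have hprod : ∀ l ∈ range M, ∀ l' ∈ range M,
      ∑ r ∈ range N, c l * c l' * cos (((l : ℤ) - l' : ℤ) * t r) * cos (t r)
        = c l * c l' * (((if l' = l + 1 then (N : ℝ) else 0) + if l = l' + 1 then (N : ℝ) else 0)
            / 2) := by
    intro l hl l' hl'
    rw [mem_range] at hl hl'
    have h1 := ht' ((l : ℤ) - l' + 1) (by rw [abs_le]; omega)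
    have h2 := ht' ((l : ℤ) - l' - 1) (by rw [abs_le]; omega)
    have e1 : ((l : ℤ) - l' + 1 = 0) ↔ l' = l + 1 := by omega
    have e2 : ((l : ℤ) - l' - 1 = 0) ↔ l = l' + 1 := by omega
    simp only [e1] at h1
    simp only [e2] at h2
    rw [← h1, ← h2, ← sum_add_distrib, sum_div, mul_sum]
    refine sum_congr rfl fun r _ => ?_
    push_cast
    rw [add_mul, sub_mul _ (1 : ℝ), one_mul, cos_add, cos_sub]
    ring
  have hshift : ∀ l ∈ range M, ∑ l' ∈ range M, c l * c l' * (if l' = l + 1 then (N : ℝ) else 0)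
      = N * (c l * c (l + 1)) := by
    intro l hl
    rw [mem_range] at hl
    rcases Nat.lt_or_ge (l + 1) M with h | h
    · rw [sum_eq_single_of_mem (l + 1) (mem_range.2 h) (fun b _ hb => by simp [hb])]
      simp
      ring
    -- At the edge l = M - 1 the neighbour lies outside the range; `hcM` makes the corresponding
    -- term on the right vanish too.
    · have : l + 1 = M := by omega
      rw [this, hcM]
      rw [sum_eq_zero]
      · simp
      · intro l' hl'
        rw [mem_range] at hl'
        rw [if_neg (by omega), mul_zero]
  calc ∑ r ∈ range N, kernel c M (t r) * cos (t r)
      = ∑ l ∈ range M, ∑ l' ∈ range M,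
          ∑ r ∈ range N, c l * c l' * cos (((l : ℤ) - l' : ℤ) * t r) * cos (t r) := by
        simp only [kernel, sum_mul]
        rw [sum_comm]
        exact sum_congr rfl fun l _ => sum_comm
    _ = ∑ l ∈ range M, ∑ l' ∈ range M, c l * c l' *
          (((if l' = l + 1 then (N : ℝ) else 0) + if l = l' + 1 then (N : ℝ) else 0) / 2) :=
        sum_congr rfl fun l hl => sum_congr rfl fun l' hl' => hprod l hl l' hl'
    _ = (∑ l ∈ range M, ∑ l' ∈ range M, c l * c l' * (if l' = l + 1 then (N : ℝ) else 0)) / 2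
        + (∑ l ∈ range M, ∑ l' ∈ range M, c l * c l' * (if l = l' + 1 then (N : ℝ) else 0)) / 2 := by
        rw [← add_div, ← sum_add_distrib, sum_div]
        refine sum_congr rfl fun l _ => ?_
        rw [← sum_add_distrib, sum_div]
        exact sum_congr rfl fun l' _ => by ring
    _ = ∑ l ∈ range M, ∑ l' ∈ range M, c l * c l' * (if l' = l + 1 then (N : ℝ) else 0) := by
        rw [sum_comm (f := fun l l' => c l * c l' * (if l = l' + 1 then (N : ℝ) else 0))]
        simp only [mul_comm (c _) (c _)]
        ring
    _ = N * ∑ l ∈ range M, c l * c (l + 1) := by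
        rw [mul_sum]
        exact sum_congr rfl hshift

/-- Concentration of the kernel near t = 0 is measured by the Dirichlet energy of its weights. The
zero boundary weights allow the shift from c (l + 1)² to c l² that completes the square. -/
lemma sum_kernel_mul_one_sub_cos (hc0 : c 0 = 0) (hcM : c M = 0)
    (ht : ∀ a : ℤ, a ≠ 0 → |a| ≤ M → ∑ r ∈ range N, cos (a * t r) = 0) :
    ∑ r ∈ range N, kernel c M (t r) * (1 - cos (t r))
      = N * (∑ l ∈ range M, (c (l + 1) - c l) ^ 2) / 2 := by
  have hS : ∑ l ∈ range M, c (l + 1) ^ 2 = ∑ l ∈ range M, c l ^ 2 := by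
    have h := sum_range_succ' (fun l => c l ^ 2) M
    rw [sum_range_succ, hcM, hc0] at h
    simpa using h.symm
  have hd : ∑ l ∈ range M, (c (l + 1) - c l) ^ 2
      = 2 * ∑ l ∈ range M, c l ^ 2 - 2 * ∑ l ∈ range M, c l * c (l + 1) := by
    have : ∑ l ∈ range M, (c (l + 1) - c l) ^ 2
        = ∑ l ∈ range M, c (l + 1) ^ 2 + ∑ l ∈ range M, c l ^ 2
          - 2 * ∑ l ∈ range M, c l * c (l + 1) := by
      rw [mul_sum, ← sum_add_distrib, ← sum_sub_distrib]
      exact sum_congr rfl fun l _ => by ring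
    rw [this, hS]
    ring
  simp only [mul_sub, mul_one, sum_sub_distrib]
  rw [sum_kernel ht, sum_kernel_mul_cos hcM ht, hd]
  ring

end Average

/-- The tent weights `0, 1, …, 2q, …, 1, 0`. -/
noncomputable def tent (q l : ℕ) : ℝ := min (l : ℝ) (4 * q - l)

lemma tent_diff_sq_le (q l : ℕ) : (tent q (l + 1) - tent q l) ^ 2 ≤ 1 := by
  rw [sq_le_one_iff_abs_le_one, abs_le]
  unfold tent
  push_cast
  constructor
  · rcases min_cases ((l : ℝ) + 1) (4 * q - (l + 1)) with h | h <;>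
      rcases min_cases (l : ℝ) (4 * q - l) with h' | h' <;> linarith [h.1, h.2, h'.1, h'.2]
  · rcases min_cases ((l : ℝ) + 1) (4 * q - (l + 1)) with h | h <;>
      rcases min_cases (l : ℝ) (4 * q - l) with h' | h' <;> linarith [h.1, h.2, h'.1, h'.2]

/-- The 2q indices in [q, 3q) have weight at least q. Mass of order q³ against energy at most 4q
yields concentration at scale 1/q. -/
lemma le_sum_tent_sq (q : ℕ) : 2 * (q : ℝ) ^ 3 ≤ ∑ l ∈ range (4 * q), tent q l ^ 2 := by
  have hsub : Ico q (3 * q) ⊆ range (4 * q) := by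
    intro l hl
    rw [mem_Ico] at hl
    rw [mem_range]
    omega
  have h1 : ∑ l ∈ Ico q (3 * q), (q : ℝ) ^ 2 ≤ ∑ l ∈ Ico q (3 * q), tent q l ^ 2 := by
    refine sum_le_sum fun l hl => ?_
    rw [mem_Ico] at hl
    have h3 : (q : ℝ) ≤ l := by exact_mod_cast hl.1
    have h4 : (l : ℝ) ≤ 3 * q := by exact_mod_cast hl.2.le
    exact pow_le_pow_left₀ (Nat.cast_nonneg q) (le_min h3 (by linarith)) 2
  refine le_trans ?_ (h1.trans (sum_le_sum_of_subset_of_nonneg hsub fun _ _ _ => sq_nonneg _))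
  rw [sum_const, Nat.card_Ico, nsmul_eq_mul, show 3 * q - q = 2 * q by omega]
  push_cast
  exact le_of_eq (by ring)

lemma abs_cos_sub_cos_le (φ ψ : ℝ) : |cos φ - cos ψ| ≤ 2 * |sin ((φ - ψ) / 2)| := by
  rw [cos_sub_cos, abs_mul, abs_mul, abs_neg, abs_two]
  have := abs_sin_le_one ((φ + ψ) / 2)
  nlinarith [abs_nonneg (sin ((φ - ψ) / 2))]

/-- AM-GM, since 1 - cos t = 2 sin²(t/2): the first-order quantity needed for Lipschitz functions is
bounded by the second-order one that the kernel controls. -/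
lemma four_mul_abs_sin_le {q : ℝ} (hq : 0 < q) (t : ℝ) :
    4 * |sin (t / 2)| ≤ 2 / q + q * (1 - cos t) := by
  have h : 1 - cos t = 2 * |sin (t / 2)| ^ 2 := by
    rw [sq_abs, sin_sq_eq_half_sub, show 2 * (t / 2) = t by ring]
    ring
  rw [h, ← sub_nonneg]
  have : 2 / q + q * (2 * |sin (t / 2)| ^ 2) - 4 * |sin (t / 2)|
      = 2 / q * (1 - q * |sin (t / 2)|) ^ 2 := by
    field_simp
    ring
  rw [this]
  positivity

/-- In the mean over the normalised kernel, 2/q comes from the constant term of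
`four_mul_abs_sin_le`. The other 1/q comes from the energy: q * (4q) / 2 = 2q², and S ≥ 2q³. -/
lemma sum_tent_kernel_mul_abs_sin_le {q N : ℕ} (hq : 0 < q) {t : ℕ → ℝ}
    (ht : ∀ a : ℤ, a ≠ 0 → |a| ≤ (4 * q : ℕ) → ∑ r ∈ range N, cos (a * t r) = 0) :
    ∑ r ∈ range N, kernel (tent q) (4 * q) (t r) * (4 * |sin (t r / 2)|)
      ≤ N * (∑ l ∈ range (4 * q), tent q l ^ 2) * (3 / q) := by
  have hq' : (0 : ℝ) < q := by exact_mod_cast hq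
  set S := ∑ l ∈ range (4 * q), tent q l ^ 2 with hS
  have h0 : tent q 0 = 0 := by simp [tent]
  have h1 : tent q (4 * q) = 0 := by simp [tent]
  have hD : ∑ l ∈ range (4 * q), (tent q (l + 1) - tent q l) ^ 2 ≤ 4 * q := by
    refine (sum_le_sum fun l _ => tent_diff_sq_le q l).trans ?_
    simp
  calc ∑ r ∈ range N, kernel (tent q) (4 * q) (t r) * (4 * |sin (t r / 2)|)
      ≤ ∑ r ∈ range N, kernel (tent q) (4 * q) (t r) * (2 / q + q * (1 - cos (t r))) :=
        sum_le_sum fun r _ =>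
          mul_le_mul_of_nonneg_left (four_mul_abs_sin_le hq' _) (kernel_nonneg _ _ _)
    _ = 2 / q * ∑ r ∈ range N, kernel (tent q) (4 * q) (t r)
        + q * ∑ r ∈ range N, kernel (tent q) (4 * q) (t r) * (1 - cos (t r)) := by
        rw [mul_sum, mul_sum, ← sum_add_distrib]
        exact sum_congr rfl fun r _ => by ring
    _ = N * (S * (2 / q) + q * (∑ l ∈ range (4 * q), (tent q (l + 1) - tent q l) ^ 2) / 2) := by
        rw [sum_kernel ht, sum_kernel_mul_one_sub_cos h0 h1 ht]
        ring
    _ ≤ N * (S * (3 / q)) := by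
        refine mul_le_mul_of_nonneg_left ?_ (Nat.cast_nonneg N)
        have h3 : (q : ℝ) * (∑ l ∈ range (4 * q), (tent q (l + 1) - tent q l) ^ 2) / 2
            ≤ 2 * (q : ℝ) ^ 2 := by nlinarith
        have h4 : 2 * (q : ℝ) ^ 2 ≤ S * (1 / q) := by
          rw [mul_one_div, le_div_iff₀ hq']
          linarith [le_sum_tent_sq q]
        have h5 : S * (3 / q) = S * (2 / q) + S * (1 / q) := by ring
        linarith
    _ = N * S * (3 / q) := by ring

/-- **Jackson's theorem** for Lipschitz functions on `[-2, 2]`, with control of the coefficients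
with respect to the rescaled Chebyshev polynomials. -/
theorem exists_chebyshev_approx {f : ℝ → ℝ} {B : ℝ}
    (hf : ∀ x ∈ Set.Icc (-2 : ℝ) 2, ∀ y ∈ Set.Icc (-2 : ℝ) 2, |f x - f y| ≤ |x - y|)
    (hB : ∀ x ∈ Set.Icc (-2 : ℝ) 2, |f x| ≤ B) {q : ℕ} (hq : 0 < q) :
    ∃ a : ℕ → ℕ → ℝ, (∀ l < 4 * q, ∀ l' < 4 * q, |a l l'| ≤ B / 2) ∧ ∀ x ∈ Set.Icc (-2 : ℝ) 2,
      |f x - ∑ l ∈ range (4 * q), ∑ l' ∈ range (4 * q),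
        a l l' * (Polynomial.Chebyshev.C ℝ ((l : ℤ) - l')).eval x| ≤ 3 / q := by
  set c := tent q with hc
  set M := 4 * q with hM
  -- With M + 1 equidistant points, no nonzero frequency of size at most M is a multiple of N, so
  -- all of them average to zero.
  set N := M + 1 with hN
  set S := ∑ l ∈ range M, c l ^ 2 with hS
  set ψ : ℕ → ℝ := fun r => 2 * π * r / N with hψ
  have hq' : (0 : ℝ) < q := by exact_mod_cast hq
  have hNpos : (0 : ℝ) < N := by positivity
  have hSpos : 0 < S := lt_of_lt_of_le (by positivity) (le_sum_tent_sq q)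
  have hNS : 0 < N * S := mul_pos hNpos hSpos
  have hmem : ∀ t, 2 * cos t ∈ Set.Icc (-2 : ℝ) 2 := fun t =>
    ⟨by linarith [neg_one_le_cos t], by linarith [cos_le_one t]⟩
  have hndvd : ∀ a : ℤ, a ≠ 0 → |a| ≤ (M : ℕ) → ¬ (N : ℤ) ∣ a := by
    intro a ha haM h
    have := Int.le_of_dvd (abs_pos.2 ha) ((dvd_abs _ _).2 h)
    omega
  have hsub : ∀ φ : ℝ, ∀ a : ℤ, a ≠ 0 → |a| ≤ (M : ℕ) →
      ∑ r ∈ range N, cos (a * (φ - ψ r)) = 0 := by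
    intro φ a ha haM
    have h := sum_cos_equidistant N (Nat.succ_pos _) (-a)
      (hndvd (-a) (neg_ne_zero.2 ha) (by rwa [abs_neg])) (a * φ)
    rw [← h]
    refine sum_congr rfl fun r _ => congrArg cos ?_
    push_cast [hψ]
    ring
  have hadd : ∀ φ : ℝ, ∀ a : ℤ, a ≠ 0 → |a| ≤ (M : ℕ) →
      ∑ r ∈ range N, cos (a * (φ + ψ r)) = 0 := by
    intro φ a ha haM
    rw [← sum_cos_equidistant N (Nat.succ_pos _) a (hndvd a ha haM) (a * φ)]
    refine sum_congr rfl fun r _ => congrArg cos ?_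
    push_cast [hψ]
    ring
  -- The coefficients are discrete Fourier coefficients of f(2 cos ψ), damped by the normalised
  -- kernel. The final factor 1/2 compensates for C_m(2 cos φ) = 2 cos(mφ).
  refine ⟨fun l l' => c l * c l' / S *
    ((∑ r ∈ range N, f (2 * cos (ψ r)) * cos (((l : ℤ) - l' : ℤ) * ψ r)) / N) / 2, ?_, ?_⟩
  · intro l hl l' hl'
    have hcc : |c l * c l' / S| ≤ 1 := by
      rw [abs_div, abs_of_pos hSpos, div_le_one hSpos, abs_mul]
      have h1 : c l ^ 2 ≤ S :=
        single_le_sum (f := fun l => c l ^ 2) (fun _ _ => sq_nonneg _) (mem_range.2 hl)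
      have h2 : c l' ^ 2 ≤ S :=
        single_le_sum (f := fun l => c l ^ 2) (fun _ _ => sq_nonneg _) (mem_range.2 hl')
      nlinarith [sq_nonneg (|c l| - |c l'|), sq_abs (c l), sq_abs (c l')]
    have hβ : |(∑ r ∈ range N, f (2 * cos (ψ r)) * cos (((l : ℤ) - l' : ℤ) * ψ r)) / N| ≤ B := by
      rw [abs_div, abs_of_pos hNpos, div_le_iff₀ hNpos]
      refine (abs_sum_le_sum_abs _ _).trans ((sum_le_card_nsmul _ _ B fun r _ => ?_).trans ?_)
      · rw [abs_mul]
        exact (mul_le_of_le_one_right (abs_nonneg _) (abs_cos_le_one _)).trans (hB _ (hmem _))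
      · rw [card_range, nsmul_eq_mul, mul_comm]
    rw [abs_div, abs_two, abs_mul]
    refine div_le_div_of_nonneg_right ?_ zero_le_two
    exact (mul_le_of_le_one_left (abs_nonneg _) hcc).trans hβ
  · intro x hx
    set φ := arccos (x / 2) with hφ
    have hxφ : x = 2 * cos φ := by
      rw [hφ, cos_arccos (by linarith [hx.1]) (by linarith [hx.2])]
      ring
    -- Symmetrising in ψ cancels the products of sines. What remains depends on φ only through
    -- cos(mφ), hence is a polynomial in x = 2 cos φ.
    set Q : ℕ → ℝ := fun r => (kernel c M (φ - ψ r) + kernel c M (φ + ψ r)) / 2 with hQ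
    have hQeq : ∀ r, Q r = ∑ l ∈ range M, ∑ l' ∈ range M, c l * c l' *
        (cos (((l : ℤ) - l' : ℤ) * φ) * cos (((l : ℤ) - l' : ℤ) * ψ r)) := by
      intro r
      simp only [hQ, kernel]
      rw [← sum_add_distrib, sum_div]
      refine sum_congr rfl fun l _ => ?_
      rw [← sum_add_distrib, sum_div]
      refine sum_congr rfl fun l' _ => ?_
      rw [mul_sub, mul_add, cos_sub, cos_add]
      ring
    have hQsum : ∑ r ∈ range N, Q r = N * S := by
      simp only [hQ]
      rw [← sum_div, sum_add_distrib, sum_kernel (t := fun r => φ - ψ r) (hsub φ),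
        sum_kernel (t := fun r => φ + ψ r) (hadd φ)]
      ring
    have hP : ∑ l ∈ range M, ∑ l' ∈ range M, c l * c l' / S *
        ((∑ r ∈ range N, f (2 * cos (ψ r)) * cos (((l : ℤ) - l' : ℤ) * ψ r)) / N) / 2 *
          (Polynomial.Chebyshev.C ℝ ((l : ℤ) - l')).eval x
        = (∑ r ∈ range N, Q r * f (2 * cos (ψ r))) / (N * S) := by
      have h1 : ∀ r, Q r * f (2 * cos (ψ r)) = ∑ l ∈ range M, ∑ l' ∈ range M, c l * c l' *
          (cos (((l : ℤ) - l' : ℤ) * φ) * cos (((l : ℤ) - l' : ℤ) * ψ r)) *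
            f (2 * cos (ψ r)) := by
        intro r
        rw [hQeq, sum_mul]
        exact sum_congr rfl fun l _ => sum_mul _ _ _
      conv_rhs => rw [sum_congr rfl fun r _ => h1 r, sum_comm, sum_div]
      refine sum_congr rfl fun l _ => ?_
      conv_rhs => rw [sum_comm, sum_div]
      refine sum_congr rfl fun l' _ => ?_
      rw [hxφ, Polynomial.Chebyshev.C_two_mul_real_cos, eq_div_iff hNS.ne']
      have h2 : ∀ A b : ℝ, c l * c l' / S * (A / N) / 2 * (2 * b) * (N * S)
          = c l * c l' * b * A := by
        intro A b
        field_simp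
      rw [h2, mul_sum]
      exact sum_congr rfl fun r _ => by ring
    have hfx : f x = (∑ r ∈ range N, Q r * f x) / (N * S) := by
      rw [← sum_mul, hQsum, mul_div_cancel_left₀ _ hNS.ne']
    rw [hP, hfx, ← sub_div, ← sum_sub_distrib, abs_div, abs_of_pos hNS, div_le_iff₀ hNS]
    -- As cos ψ = cos(-ψ), the difference of the values of f is bounded by 4|sin((φ - ψ)/2)| and by
    -- 4|sin((φ + ψ)/2)|. Each half of Q is paired with the bound in its own argument.
    have hterm : ∀ r, |Q r * f x - Q r * f (2 * cos (ψ r))|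
        ≤ (kernel c M (φ - ψ r) * (4 * |sin ((φ - ψ r) / 2)|)
          + kernel c M (φ + ψ r) * (4 * |sin ((φ + ψ r) / 2)|)) / 2 := by
      intro r
      have k1 := kernel_nonneg c M (φ - ψ r)
      have k2 := kernel_nonneg c M (φ + ψ r)
      have hd : |f x - f (2 * cos (ψ r))| ≤ 2 * |cos φ - cos (ψ r)| := by
        refine (hf x hx _ (hmem _)).trans (le_of_eq ?_)
        rw [hxφ, ← mul_sub, abs_mul, abs_two]
      have d1 := abs_cos_sub_cos_le φ (ψ r)
      have d2 := abs_cos_sub_cos_le φ (-ψ r)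
      rw [cos_neg, sub_neg_eq_add] at d2
      have hQnn : 0 ≤ Q r := by simp only [hQ]; linarith
      rw [← mul_sub, abs_mul, abs_of_nonneg hQnn]
      have e1 := mul_le_mul_of_nonneg_left
        (show |f x - f (2 * cos (ψ r))| ≤ 4 * |sin ((φ - ψ r) / 2)| by linarith) k1
      have e2 := mul_le_mul_of_nonneg_left
        (show |f x - f (2 * cos (ψ r))| ≤ 4 * |sin ((φ + ψ r) / 2)| by linarith) k2
      simp only [hQ]
      linarith
    refine (abs_sum_le_sum_abs _ _).trans ((sum_le_sum fun r _ => hterm r).trans ?_)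
    rw [← sum_div, sum_add_distrib]
    have s1 := sum_tent_kernel_mul_abs_sin_le hq (t := fun r => φ - ψ r) (hsub φ)
    have s2 := sum_tent_kernel_mul_abs_sin_le hq (t := fun r => φ + ψ r) (hadd φ)
    linarith

end JacksonKernel

/-! ### Wasserstein distance on the line: the quantile coupling -/

namespace RealTransport

open ProbabilityTheory Set Filter Topology

/-- The quantile function of a distribution on the real line, with value `0` outside `(0, 1)`. -/
noncomputable def quantile (μ : Measure ℝ) (u : ℝ) : ℝ :=
  open Classical in if u ∈ Ioo (0 : ℝ) 1 then sInf {x | u ≤ cdf μ x} else 0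

/-- The Galois connection between quantile and distribution function. Right-continuity of the latter
shows that the infimum is attained. -/
lemma quantile_le_iff (μ : Measure ℝ) {u : ℝ} (hu : u ∈ Ioo (0 : ℝ) 1) (x : ℝ) :
    quantile μ u ≤ x ↔ u ≤ cdf μ x := by
  rw [quantile, if_pos hu]
  have hbdd : BddBelow {x | u ≤ cdf μ x} := by
    obtain ⟨b, hb⟩ := ((tendsto_cdf_atBot μ).eventually_lt_const hu.1).exists
    refine ⟨b, fun y hy => ?_⟩
    by_contra! h
    exact absurd (monotone_cdf μ h.le) (not_le.2 (hb.trans_le hy))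
  have hne : {x | u ≤ cdf μ x}.Nonempty := by
    obtain ⟨b, hb⟩ := ((tendsto_cdf_atTop μ).eventually_const_lt hu.2).exists
    exact ⟨b, hb.le⟩
  refine ⟨fun h => ?_, fun h => csInf_le hbdd h⟩
  have hev : ∀ᶠ y in 𝓝[>] x, u ≤ cdf μ y := by
    filter_upwards [self_mem_nhdsWithin] with y hy
    obtain ⟨z, hz, hzy⟩ := (csInf_lt_iff hbdd hne).1 (h.trans_lt hy)
    exact hz.trans (monotone_cdf μ hzy.le)
  have hc : Tendsto (cdf μ) (𝓝[>] x) (𝓝 (cdf μ x)) :=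
    ((cdf μ).right_continuous x).mono_left (nhdsWithin_mono _ Ioi_subset_Ici_self)
  exact ge_of_tendsto hc hev

lemma measurable_quantile (μ : Measure ℝ) : Measurable (quantile μ) := by
  refine measurable_of_Iic fun x => ?_
  have : quantile μ ⁻¹' Iic x
      = (Ioo 0 1 ∩ Iic (cdf μ x)) ∪ ((Ioo (0 : ℝ) 1)ᶜ ∩ {_u | (0 : ℝ) ≤ x}) := by
    ext u
    by_cases hu : u ∈ Ioo (0 : ℝ) 1
    · have := quantile_le_iff μ hu x
      simp only [mem_preimage, mem_Iic, mem_union, mem_inter_iff, mem_compl_iff, hu, this]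
      simp
    · have : quantile μ u = 0 := by rw [quantile, if_neg hu]
      simp only [mem_preimage, mem_Iic, mem_union, mem_inter_iff, mem_compl_iff, hu, this]
      simp
  rw [this]
  exact (measurableSet_Ioo.inter measurableSet_Iic).union
    (measurableSet_Ioo.compl.inter (MeasurableSet.const _))

/-- Inverse transform sampling: for uniform u, the event that the quantile is at most x is u ≤ F(x),
of probability F(x). -/
lemma map_quantile (μ : Measure ℝ) [IsProbabilityMeasure μ] :
    (volume.restrict (Ioo (0 : ℝ) 1)).map (quantile μ) = μ := by
  have : IsFiniteMeasure ((volume.restrict (Ioo (0 : ℝ) 1)).map (quantile μ)) :=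
    inferInstance
  refine Measure.ext_of_Iic _ _ fun x => ?_
  rw [Measure.map_apply (measurable_quantile μ) measurableSet_Iic,
    Measure.restrict_apply (measurable_quantile μ measurableSet_Iic), ← ofReal_cdf μ x]
  have hset : quantile μ ⁻¹' Iic x ∩ Ioo 0 1 = Ioo 0 1 ∩ Iic (cdf μ x) := by
    ext u
    rw [inter_comm]
    refine and_congr_right fun hu => ?_
    exact quantile_le_iff μ hu x
  rw [hset]
  refine le_antisymm ?_ ?_
  · refine (measure_mono (t := Icc 0 (cdf μ x)) fun u hu => ⟨hu.1.1.le, hu.2⟩).trans ?_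
    rw [Real.volume_Icc, sub_zero]
  · refine le_trans (le_of_eq ?_) (measure_mono (s := Ioo 0 (cdf μ x)) fun u hu =>
      ⟨⟨hu.1, hu.2.trans_le (cdf_le_one μ x)⟩, hu.2.le⟩)
    rw [Real.volume_Ioo, sub_zero]

/-- The Wasserstein-1 distance is at most the `L¹` distance of the distribution functions. -/
theorem wasserstein1_le_lintegral_cdf (μ ν : Measure ℝ) [IsProbabilityMeasure μ]
    [IsProbabilityMeasure ν] :
    wasserstein1 μ ν ≤ ∫⁻ x, ENNReal.ofReal |cdf μ x - cdf ν x| := by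
  set lam := volume.restrict (Ioo (0 : ℝ) 1) with hlam
  have hmeas : Measurable fun u => (quantile μ u, quantile ν u) :=
    (measurable_quantile μ).prodMk (measurable_quantile ν)
  -- The monotone coupling: both quantile functions are evaluated at the same uniform u.
  refine (iInf₂_le (lam.map fun u => (quantile μ u, quantile ν u)) ⟨?_, ?_⟩).trans ?_
  rotate_left
  · rw [Measure.map_map measurable_fst hmeas]
    exact map_quantile μ
  · rw [Measure.map_map measurable_snd hmeas]
    exact map_quantile ν
  rw [lintegral_map (by fun_prop) hmeas]
  -- D is the region between the two graphs. Its section at fixed u contains the interval between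
  -- the quantiles, and its section at fixed x lies between the two values of the distribution
  -- functions. Tonelli's theorem compares the two.
  set D : Set (ℝ × ℝ) := {z | ¬ (z.1 ≤ cdf μ z.2 ↔ z.1 ≤ cdf ν z.2)} with hD
  have hDm : MeasurableSet D := by
    have h : ∀ ρ : Measure ℝ, MeasurableSet {z : ℝ × ℝ | z.1 ≤ cdf ρ z.2} := fun ρ =>
      measurableSet_le measurable_fst ((monotone_cdf ρ).measurable.comp measurable_snd)
    exact (MeasurableSet.iff (h μ) (h ν)).compl
  have h1 : ∀ u ∈ Ioo (0 : ℝ) 1, ENNReal.ofReal |quantile μ u - quantile ν u|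
      ≤ ∫⁻ x, D.indicator 1 (u, x) := by
    intro u hu
    have hsec : ∀ x, D.indicator (1 : ℝ × ℝ → ℝ≥0∞) (u, x)
        = (Prod.mk u ⁻¹' D).indicator 1 x := fun x => rfl
    simp only [hsec]
    rw [lintegral_indicator_one (measurable_prodMk_left hDm)]
    have hsub : Ico (min (quantile μ u) (quantile ν u)) (max (quantile μ u) (quantile ν u))
        ⊆ Prod.mk u ⁻¹' D := by
      intro x hx
      simp only [hD, mem_preimage, mem_ofPred_eq, ← quantile_le_iff μ hu, ← quantile_le_iff ν hu]
      rw [mem_Ico, min_le_iff, lt_max_iff] at hx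
      intro hiff
      rcases hx.1 with h | h
      · exact hx.2.elim (fun h' => absurd h (not_le.2 h'))
          fun h' => absurd (hiff.1 h) (not_le.2 h')
      · exact hx.2.elim (fun h' => absurd (hiff.2 h) (not_le.2 h'))
          fun h' => absurd h (not_le.2 h')
    refine le_trans (le_of_eq ?_) (measure_mono hsub)
    rw [Real.volume_Ico, max_sub_min_eq_abs, abs_sub_comm]
  calc ∫⁻ u, ENNReal.ofReal |quantile μ u - quantile ν u| ∂lam
      ≤ ∫⁻ u, (∫⁻ x, D.indicator 1 (u, x)) ∂lam :=
        setLIntegral_mono' measurableSet_Ioo h1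
    _ = ∫⁻ x, ∫⁻ u, D.indicator 1 (u, x) ∂lam :=
        lintegral_lintegral_swap
          (((measurable_indicator_const_iff (1 : ℝ≥0∞)).2 hDm).aemeasurable)
    _ ≤ ∫⁻ x, ENNReal.ofReal |cdf μ x - cdf ν x| := by
        refine lintegral_mono fun x => ?_
        have hsec : ∀ u, D.indicator (1 : ℝ × ℝ → ℝ≥0∞) (u, x)
            = ((fun u => (u, x)) ⁻¹' D).indicator 1 u := fun u => rfl
        simp only [hsec]
        rw [lintegral_indicator_one (measurable_prodMk_right hDm)]
        have hsub : (fun u => (u, x)) ⁻¹' D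
            ⊆ Ioc (min (cdf μ x) (cdf ν x)) (max (cdf μ x) (cdf ν x)) := by
          intro u hu
          simp only [hD, mem_preimage, mem_ofPred_eq] at hu
          rw [mem_Ioc, min_lt_iff, le_max_iff]
          by_cases ha : u ≤ cdf μ x <;> by_cases hb : u ≤ cdf ν x
          · exact absurd ⟨fun _ => hb, fun _ => ha⟩ hu
          · exact ⟨Or.inr (not_le.1 hb), Or.inl ha⟩
          · exact ⟨Or.inl (not_le.1 ha), Or.inr hb⟩
          · exact absurd ⟨fun h => absurd h ha, fun h => absurd h hb⟩ hu
        refine ((Measure.restrict_apply_le _ _).trans (measure_mono hsub)).trans (le_of_eq ?_)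
        rw [Real.volume_Ioc, max_sub_min_eq_abs, abs_sub_comm]

/-! ### Kantorovich–Rubinstein duality on [-2, 2] -/

section Dual

variable {p s : Measure ℝ}

/-- The potential of the optimal transport on `[-2, 2]`. -/
noncomputable def potential (p s : Measure ℝ) (y : ℝ) : ℝ :=
  ∫ x in y..2, ((SignType.sign (cdf p x - cdf s x) : SignType) : ℝ)

lemma measurable_sign_cdf (p s : Measure ℝ) :
    Measurable fun x => ((SignType.sign (cdf p x - cdf s x) : SignType) : ℝ) := by
  have h : Measurable fun x => cdf p x - cdf s x :=
    (monotone_cdf p).measurable.sub (monotone_cdf s).measurable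
  have h2 : Measurable fun t : ℝ => ((SignType.sign t : SignType) : ℝ) := by
    have : (fun t : ℝ => ((SignType.sign t : SignType) : ℝ))
        = fun t => if 0 < t then (1 : ℝ) else if t < 0 then -1 else 0 := by
      funext t
      rcases lt_trichotomy t 0 with h | h | h
      · simp [h, h.le.not_gt]
      · simp [h]
      · simp [h]
    rw [this]
    exact Measurable.ite measurableSet_Ioi measurable_const
      (Measurable.ite measurableSet_Iio measurable_const measurable_const)
  exact h2.comp h

lemma abs_sign_le_one (t : ℝ) : |((SignType.sign t : SignType) : ℝ)| ≤ 1 := by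
  rcases lt_trichotomy t 0 with h | h | h <;> simp [h]

lemma intervalIntegrable_sign_cdf (p s : Measure ℝ) (a b : ℝ) :
    IntervalIntegrable (fun x => ((SignType.sign (cdf p x - cdf s x) : SignType) : ℝ))
      volume a b := by
  refine (intervalIntegrable_const (c := (1 : ℝ))).mono_fun
    (measurable_sign_cdf p s).aestronglyMeasurable (Eventually.of_forall fun x => ?_)
  simpa using abs_sign_le_one _

lemma abs_potential_sub_le (p s : Measure ℝ) (x y : ℝ) :
    |potential p s x - potential p s y| ≤ |x - y| := by
  have h : potential p s x - potential p s y
      = ∫ t in x..y, ((SignType.sign (cdf p t - cdf s t) : SignType) : ℝ) := by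
    unfold potential
    rw [sub_eq_iff_eq_add, intervalIntegral.integral_add_adjacent_intervals] <;>
      exact intervalIntegrable_sign_cdf _ _ _ _
  have := intervalIntegral.norm_integral_le_of_norm_le_const (a := x) (b := y) (C := 1)
    (f := fun t => ((SignType.sign (cdf p t - cdf s t) : SignType) : ℝ))
    (fun t _ => abs_sign_le_one _)
  rw [h]
  rw [one_mul, abs_sub_comm] at this
  exact this

lemma abs_potential_le (p s : Measure ℝ) {x : ℝ} (hx : x ∈ Icc (-2 : ℝ) 2) :
    |potential p s x| ≤ 4 := by
  have h := abs_potential_sub_le p s x 2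
  have h2 : potential p s 2 = 0 := by simp [potential]
  rw [h2, sub_zero] at h
  refine h.trans (abs_le.2 ⟨?_, ?_⟩) <;> linarith [hx.1, hx.2]

lemma continuous_potential (p s : Measure ℝ) : Continuous (potential p s) := by
  refine (LipschitzWith.of_dist_le_mul (K := 1) fun x y => ?_).continuous
  simpa [Real.dist_eq] using abs_potential_sub_le p s x y

lemma ae_mem_Icc {ρ : Measure ℝ} (hρ : DiffSpectrum.IsCandidate ρ) :
    ∀ᵐ x ∂ρ, x ∈ Icc (-2 : ℝ) 2 := mem_ae_iff.2 hρ.2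

lemma integrable_of_continuous {ρ : Measure ℝ} (hρ : DiffSpectrum.IsCandidate ρ) {f : ℝ → ℝ}
    (hf : Continuous f) : Integrable f ρ := by
  have := hρ.1
  obtain ⟨C, hC⟩ := isCompact_Icc.exists_bound_of_continuousOn
    (hf.continuousOn (s := Icc (-2 : ℝ) 2))
  exact Integrable.of_bound hf.aestronglyMeasurable C ((ae_mem_Icc hρ).mono hC)

/-- Fubini: the potential at y integrates the sign over those x in [-2, 2] with y ≤ x, and averaging
the condition y ≤ x over ρ gives the distribution function at x. -/
lemma integral_potential {ρ : Measure ℝ} (hρ : DiffSpectrum.IsCandidate ρ) (p s : Measure ℝ) :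
    ∫ y, potential p s y ∂ρ
      = ∫ x in Icc (-2 : ℝ) 2, SignType.sign (cdf p x - cdf s x) * cdf ρ x := by
  have := hρ.1
  set σ : ℝ → ℝ := fun x => ((SignType.sign (cdf p x - cdf s x) : SignType) : ℝ) with hσ
  have hσm : Measurable σ := measurable_sign_cdf p s
  have h1 : ∀ y ∈ Icc (-2 : ℝ) 2, potential p s y
      = ∫ x in Icc (-2 : ℝ) 2, σ x * (if y ≤ x then 1 else 0) := by
    intro y hy
    rw [potential, intervalIntegral.integral_of_le hy.2, ← integral_Icc_eq_integral_Ioc]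
    have hset : Icc y 2 = Icc (-2) 2 ∩ Ici y := by
      ext x
      simp only [mem_Icc, mem_inter_iff, mem_Ici]
      exact ⟨fun h => ⟨⟨hy.1.trans h.1, h.2⟩, h.1⟩, fun h => ⟨h.2, h.1.2⟩⟩
    rw [hset, ← setIntegral_indicator measurableSet_Ici]
    refine integral_congr_ae (Eventually.of_forall fun x => ?_)
    by_cases h : y ≤ x <;> simp [indicator, h, hσ]
  have hint : Integrable (Function.uncurry fun (y x : ℝ) => σ x * (if y ≤ x then (1 : ℝ) else 0))
      (ρ.prod (volume.restrict (Icc (-2 : ℝ) 2))) := by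
    refine Integrable.of_bound (C := 1) ?_ (Eventually.of_forall fun z => ?_)
    · refine Measurable.aestronglyMeasurable ?_
      exact (hσm.comp measurable_snd).mul (Measurable.ite
        (measurableSet_le measurable_fst measurable_snd) measurable_const measurable_const)
    · simp only [Function.uncurry]
      split_ifs
      · simpa [hσ] using abs_sign_le_one _
      · simp
  calc ∫ y, potential p s y ∂ρ
      = ∫ y, (∫ x in Icc (-2 : ℝ) 2, σ x * (if y ≤ x then 1 else 0)) ∂ρ :=
        integral_congr_ae ((ae_mem_Icc hρ).mono h1)
    _ = ∫ x in Icc (-2 : ℝ) 2, (∫ y, σ x * (if y ≤ x then 1 else 0) ∂ρ) :=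
        integral_integral_swap hint
    _ = ∫ x in Icc (-2 : ℝ) 2, σ x * cdf ρ x := by
        refine integral_congr_ae (Eventually.of_forall fun x => ?_)
        simp only
        rw [integral_const_mul, cdf_eq_real]
        congr 1
        have : (fun y : ℝ => if y ≤ x then (1 : ℝ) else 0) = (Iic x).indicator 1 := by
          funext y
          simp [indicator]
        rw [this, integral_indicator_one measurableSet_Iic]

lemma cdf_eq_of_notMem {ρ : Measure ℝ} (hρ : DiffSpectrum.IsCandidate ρ) {x : ℝ}
    (hx : x ∉ Icc (-2 : ℝ) 2) : cdf ρ x = if x < -2 then 0 else 1 := by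
  have := hρ.1
  rw [cdf_eq_real]
  split_ifs with h
  · rw [measureReal_def, measure_mono_null _ hρ.2, ENNReal.toReal_zero]
    intro y hy hy'
    exact absurd (hy'.1.trans hy) (not_le.2 h)
  · have h2 : 2 < x := by
      by_contra! h3
      exact hx ⟨not_lt.1 h, h3⟩
    have : ρ (Iic x) = 1 := by
      rw [prob_compl_eq_zero_iff measurableSet_Iic |>.symm]
      refine measure_mono_null ?_ hρ.2
      intro y hy hy'
      exact hy (hy'.2.trans h2.le)
    rw [measureReal_def, this, ENNReal.toReal_one]

/-- **Kantorovich–Rubinstein duality** on `[-2, 2]`, in the form of an explicit potential. -/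
theorem wasserstein1_le_integral_potential (hp : DiffSpectrum.IsCandidate p)
    (hs : DiffSpectrum.IsCandidate s) :
    wasserstein1 p s
      ≤ ENNReal.ofReal (∫ y, potential p s y ∂p - ∫ y, potential p s y ∂s) := by
  have := hp.1
  have := hs.1
  refine (wasserstein1_le_lintegral_cdf p s).trans ?_
  have hcm : ∀ ρ : Measure ℝ, Measurable (cdf ρ) := fun ρ => (monotone_cdf ρ).measurable
  have hint : ∀ ρ : Measure ℝ, IntegrableOn
      (fun x => (SignType.sign (cdf p x - cdf s x) : ℝ) * cdf ρ x) (Icc (-2 : ℝ) 2) := by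
    intro ρ
    refine Integrable.of_bound (C := 1)
      ((measurable_sign_cdf p s).mul (hcm ρ)).aestronglyMeasurable
      (Eventually.of_forall fun x => ?_)
    rw [norm_mul]
    refine mul_le_one₀ (abs_sign_le_one _) (norm_nonneg _) ?_
    rw [Real.norm_of_nonneg (cdf_nonneg ρ x)]
    exact cdf_le_one ρ x
  have hout : ∀ x ∉ Icc (-2 : ℝ) 2, |cdf p x - cdf s x| = 0 := by
    intro x hx
    rw [cdf_eq_of_notMem hp hx, cdf_eq_of_notMem hs hx, sub_self, abs_zero]
  -- The sign in the potential is chosen so that the difference of the two integrals is exactly the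
  -- L¹ distance of the distribution functions.
  have hsgn : ∀ x, (SignType.sign (cdf p x - cdf s x) : ℝ) * cdf p x
      - SignType.sign (cdf p x - cdf s x) * cdf s x = |cdf p x - cdf s x| := by
    intro x
    rw [← mul_sub, sign_mul_self]
  rw [integral_potential hp, integral_potential hs, ← integral_sub (hint p) (hint s)]
  simp only [hsgn]
  have hi := (hint p).sub (hint s)
  have hi' : IntegrableOn (fun x => |cdf p x - cdf s x|) (Icc (-2 : ℝ) 2) :=
    hi.congr (Eventually.of_forall hsgn)
  rw [ofReal_integral_eq_lintegral_ofReal hi' (Eventually.of_forall fun x => abs_nonneg _),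
    ← lintegral_indicator measurableSet_Icc]
  refine lintegral_mono fun x => ?_
  by_cases hx : x ∈ Icc (-2 : ℝ) 2
  · rw [indicator_of_mem hx]
  · rw [hout x hx]
    simp

end Dual

/-! ### From close moments to small Wasserstein distance -/

section Moments

open Polynomial

variable {p s : Measure ℝ} {k : ℕ} {η : ℝ}

/-- Induction with C_{j+2} = X C_{j+1} - C_j. The free power x^i absorbs the factor X, and the
errors add up as 2 * 2^(j+1) + 2 * 2^j ≤ 2 * 2^(j+2). -/
lemma abs_integral_chebyshev_sub_le (hp : DiffSpectrum.IsCandidate p)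
    (hs : DiffSpectrum.IsCandidate s)
    (hm : ∀ j ≤ k, |rawMoment p j - rawMoment s j| ≤ η) (j : ℕ) :
    ∀ i, i + j ≤ k → |∫ x, x ^ i * (Chebyshev.C ℝ (j : ℤ)).eval x ∂p
      - ∫ x, x ^ i * (Chebyshev.C ℝ (j : ℤ)).eval x ∂s| ≤ 2 * 2 ^ j * η := by
  have hη : 0 ≤ η := (abs_nonneg _).trans (hm 0 (Nat.zero_le _))
  induction j using Nat.twoStepInduction with
  | zero =>
    intro i hi
    have := hm i (by omega)
    simp only [rawMoment] at this
    simp only [Nat.cast_zero, Chebyshev.C_zero, eval_ofNat]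
    rw [integral_mul_const, integral_mul_const, ← sub_mul, abs_mul, abs_two]
    linarith
  | one =>
    intro i hi
    have := hm (i + 1) (by omega)
    simp only [rawMoment, pow_succ] at this
    simp only [Nat.cast_one, Chebyshev.C_one, eval_X]
    linarith
  | more j ih0 ih1 =>
    intro i hi
    have h0 := ih0 i (by omega)
    have h1 := ih1 (i + 1) (by omega)
    have hrec : ∀ ρ, DiffSpectrum.IsCandidate ρ →
        ∫ x, x ^ i * (Chebyshev.C ℝ ((j + 2 : ℕ) : ℤ)).eval x ∂ρ
        = ∫ x, x ^ (i + 1) * (Chebyshev.C ℝ ((j + 1 : ℕ) : ℤ)).eval x ∂ρ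
          - ∫ x, x ^ i * (Chebyshev.C ℝ (j : ℤ)).eval x ∂ρ := by
      intro ρ hρ
      rw [← integral_sub]
      · refine integral_congr_ae (Eventually.of_forall fun x => ?_)
        push_cast
        simp only [Chebyshev.C_add_two, eval_sub, eval_mul, eval_X]
        ring
      · exact integrable_of_continuous hρ (by fun_prop)
      · exact integrable_of_continuous hρ (by fun_prop)
    rw [hrec p hp, hrec s hs]
    rw [abs_le] at h0 h1 ⊢
    have h2 : 0 ≤ 2 ^ j * η := by positivity
    simp only [pow_succ] at h0 h1 ⊢
    constructor <;> linarith [h0.1, h0.2, h1.1, h1.2]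

lemma abs_integral_chebyshev_int_sub_le (hp : DiffSpectrum.IsCandidate p)
    (hs : DiffSpectrum.IsCandidate s)
    (hm : ∀ j ≤ k, |rawMoment p j - rawMoment s j| ≤ η) {a : ℤ} (ha : a.natAbs ≤ k) :
    |∫ x, (Chebyshev.C ℝ a).eval x ∂p - ∫ x, (Chebyshev.C ℝ a).eval x ∂s|
      ≤ 2 * 2 ^ k * η := by
  have hη : 0 ≤ η := (abs_nonneg _).trans (hm 0 (Nat.zero_le _))
  have h := abs_integral_chebyshev_sub_le hp hs hm a.natAbs 0 (by omega)
  simp only [pow_zero, one_mul, Chebyshev.C_natAbs] at h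
  refine h.trans ?_
  gcongr
  norm_num

/-- Two distributions on `[-2, 2]` with nearly equal low moments are close in Wasserstein-1
distance. -/
theorem wasserstein1_le_of_moments (hp : DiffSpectrum.IsCandidate p)
    (hs : DiffSpectrum.IsCandidate s)
    (hm : ∀ j ≤ k, |rawMoment p j - rawMoment s j| ≤ η) {q : ℕ} (hq : 0 < q) (hqk : 4 * q ≤ k) :
    wasserstein1 p s ≤ ENNReal.ofReal (6 / q + 4 * (k : ℝ) ^ 2 * 2 ^ k * η) := by
  have := hp.1
  have := hs.1
  have hη : 0 ≤ η := (abs_nonneg _).trans (hm 0 (Nat.zero_le _))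
  refine (wasserstein1_le_integral_potential hp hs).trans (ENNReal.ofReal_le_ofReal ?_)
  -- The potential vanishes at 2 and is 1-Lipschitz, so it is at most 4 on [-2, 2], and the
  -- coefficients are at most 2. The approximation error 3/q enters once for p and once for s.
  obtain ⟨a, ha, hfa⟩ := JacksonKernel.exists_chebyshev_approx (f := potential p s) (B := 4)
    (fun x _ y _ => abs_potential_sub_le p s x y) (fun x hx => abs_potential_le p s hx) hq
  set P : ℝ → ℝ := fun x => ∑ l ∈ Finset.range (4 * q), ∑ l' ∈ Finset.range (4 * q),
    a l l' * (Chebyshev.C ℝ ((l : ℤ) - l')).eval x with hP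
  have hPc : Continuous P := by fun_prop
  have happ : ∀ ρ, DiffSpectrum.IsCandidate ρ →
      |∫ x, potential p s x ∂ρ - ∫ x, P x ∂ρ| ≤ 3 / q := by
    intro ρ hρ
    have := hρ.1
    rw [← integral_sub (integrable_of_continuous hρ (continuous_potential p s))
      (integrable_of_continuous hρ hPc)]
    have := norm_integral_le_of_norm_le_const (μ := ρ) (C := 3 / q)
      (f := fun x => potential p s x - P x) ((ae_mem_Icc hρ).mono fun x hx => hfa x hx)
    simpa using this
  have hPint : ∀ ρ, DiffSpectrum.IsCandidate ρ → ∫ x, P x ∂ρ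
      = ∑ l ∈ Finset.range (4 * q), ∑ l' ∈ Finset.range (4 * q),
        a l l' * ∫ x, (Chebyshev.C ℝ ((l : ℤ) - l')).eval x ∂ρ := by
    intro ρ hρ
    simp only [hP]
    rw [integral_finsetSum _ fun l _ => integrable_of_continuous hρ (by fun_prop)]
    refine Finset.sum_congr rfl fun l _ => ?_
    rw [integral_finsetSum _ fun l' _ => integrable_of_continuous hρ (by fun_prop)]
    exact Finset.sum_congr rfl fun l' _ => integral_const_mul _ _
  have hPdiff : |∫ x, P x ∂p - ∫ x, P x ∂s| ≤ 4 * (k : ℝ) ^ 2 * 2 ^ k * η := by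
    rw [hPint p hp, hPint s hs, ← Finset.sum_sub_distrib]
    have hterm : ∀ l ∈ Finset.range (4 * q), ∀ l' ∈ Finset.range (4 * q),
        |a l l' * ∫ x, (Chebyshev.C ℝ ((l : ℤ) - l')).eval x ∂p
          - a l l' * ∫ x, (Chebyshev.C ℝ ((l : ℤ) - l')).eval x ∂s| ≤ 4 * 2 ^ k * η := by
      intro l hl l' hl'
      rw [Finset.mem_range] at hl hl'
      rw [← mul_sub, abs_mul]
      have h1 := ha l hl l' hl'
      have h2 := abs_integral_chebyshev_int_sub_le hp hs hm (a := (l : ℤ) - l') (by omega)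
      calc _ ≤ (4 / 2 : ℝ) * (2 * 2 ^ k * η) :=
            mul_le_mul h1 h2 (abs_nonneg _) (by norm_num)
        _ = _ := by ring
    calc _ ≤ ∑ l ∈ Finset.range (4 * q), ∑ l' ∈ Finset.range (4 * q), 4 * 2 ^ k * η := by
          refine (Finset.abs_sum_le_sum_abs _ _).trans (Finset.sum_le_sum fun l hl => ?_)
          rw [← Finset.sum_sub_distrib]
          exact (Finset.abs_sum_le_sum_abs _ _).trans (Finset.sum_le_sum fun l' hl' =>
            hterm l hl l' hl')
      _ = ((4 * q : ℕ) : ℝ) ^ 2 * (4 * 2 ^ k * η) := by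
          simp only [Finset.sum_const, Finset.card_range, nsmul_eq_mul]
          ring
      _ ≤ (k : ℝ) ^ 2 * (4 * 2 ^ k * η) := by
          have : ((4 * q : ℕ) : ℝ) ≤ k := by exact_mod_cast hqk
          gcongr
      _ = _ := by ring
  have h1 := abs_le.1 (happ p hp)
  have h2 := abs_le.1 (happ s hs)
  have h3 := abs_le.1 hPdiff
  have h4 : (6 : ℝ) / q = 3 / q + 3 / q := by ring
  linarith [h1.1, h1.2, h2.1, h2.2, h3.1, h3.2]

end Moments

end RealTransport

/-! ### Spectral moments as return probabilities -/

namespace RandomWalkTrace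

open Matrix

variable {n : ℕ}

lemma trace_pow_eq_sum_eigenvalues_pow {M : Matrix (Fin n) (Fin n) ℝ} (hM : M.IsHermitian)
    (j : ℕ) : (M ^ j).trace = ∑ i, hM.eigenvalues i ^ j := by
  conv_lhs => rw [hM.spectral_theorem, ← map_pow, Unitary.conjStarAlgAut_apply,
    Matrix.trace_mul_cycle, Unitary.coe_star_mul_self, one_mul, Matrix.diagonal_pow,
    Matrix.trace_diagonal]
  simp

lemma isProbabilityMeasure_spectralDensity [NeZero n] {M : Matrix (Fin n) (Fin n) ℝ}
    (hM : M.IsHermitian) : IsProbabilityMeasure (spectralDensity hM) := by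
  constructor
  simp only [spectralDensity, Measure.smul_apply, Measure.finsetSum_apply, measure_univ,
    Finset.sum_const, Finset.card_univ, Fintype.card_fin, nsmul_eq_mul, mul_one, smul_eq_mul]
  exact ENNReal.inv_mul_cancel (by exact_mod_cast NeZero.ne n) (ENNReal.natCast_ne_top n)

lemma rawMoment_spectralDensity {M : Matrix (Fin n) (Fin n) ℝ} (hM : M.IsHermitian) (j : ℕ) :
    rawMoment (spectralDensity hM) j = (n : ℝ)⁻¹ * (M ^ j).trace := by
  rw [rawMoment, spectralDensity, integral_smul_measure, trace_pow_eq_sum_eigenvalues_pow hM,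
    integral_finsetSum_measure fun i _ => integrable_dirac (by simp)]
  simp

/-- With z = D^(-1/2) y, AM-GM bounds each product z u * z v by (z u² + z v²)/2. By symmetry of the
weights both halves sum to the same quantity, in total the sum of z u² deg u. -/
lemma abs_dotProduct_normalizedAdj_le (G : WeightedGraph n) (y : Fin n → ℝ) :
    |y ⬝ᵥ (G.normalizedAdj *ᵥ y)| ≤ y ⬝ᵥ y := by
  have hexp : y ⬝ᵥ (G.normalizedAdj *ᵥ y) = ∑ u, ∑ v, G.adj u v *
      ((y u * (√(G.degree u))⁻¹) * (y v * (√(G.degree v))⁻¹)) := by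
    simp only [dotProduct, mulVec, Finset.mul_sum]
    refine Finset.sum_congr rfl fun u _ => Finset.sum_congr rfl fun v _ => ?_
    simp only [WeightedGraph.normalizedAdj, WeightedGraph.invSqrtDegree, mul_diagonal,
      diagonal_mul]
    ring
  set z : Fin n → ℝ := fun u => y u * (√(G.degree u))⁻¹ with hz
  -- Equality holds at positive degree; at degree 0 the left side vanishes.
  have hrow : ∀ u, z u ^ 2 * G.degree u ≤ y u * y u := by
    intro u
    rcases (G.degree_nonneg u).eq_or_lt with h | h
    · rw [← h, mul_zero]
      exact mul_self_nonneg _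
    · rw [hz]
      simp only [mul_pow, inv_pow, Real.sq_sqrt h.le]
      rw [mul_assoc, inv_mul_cancel₀ h.ne']
      linarith
  have h1 : ∑ u, ∑ v, G.adj u v * (z u ^ 2 / 2) = ∑ u, z u ^ 2 * G.degree u / 2 := by
    refine Finset.sum_congr rfl fun u _ => ?_
    rw [← Finset.sum_mul, WeightedGraph.degree]
    ring
  have h2 : ∑ u, ∑ v, G.adj u v * (z v ^ 2 / 2) = ∑ u, z u ^ 2 * G.degree u / 2 := by
    rw [Finset.sum_comm, ← h1]
    exact Finset.sum_congr rfl fun u _ => Finset.sum_congr rfl fun v _ => by rw [G.symm]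
  calc |y ⬝ᵥ (G.normalizedAdj *ᵥ y)|
      ≤ ∑ u, ∑ v, G.adj u v * (z u ^ 2 / 2 + z v ^ 2 / 2) := by
        rw [hexp]
        refine (Finset.abs_sum_le_sum_abs _ _).trans (Finset.sum_le_sum fun u _ => ?_)
        refine (Finset.abs_sum_le_sum_abs _ _).trans (Finset.sum_le_sum fun v _ => ?_)
        rw [abs_mul, abs_of_nonneg (G.nonneg u v)]
        refine mul_le_mul_of_nonneg_left ?_ (G.nonneg u v)
        rw [abs_le]
        constructor <;> nlinarith [sq_nonneg (z u + z v), sq_nonneg (z u - z v)]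
    _ = ∑ u, z u ^ 2 * G.degree u := by
        simp only [mul_add, Finset.sum_add_distrib]
        rw [h1, h2, ← Finset.sum_add_distrib]
        exact Finset.sum_congr rfl fun u _ => by ring
    _ ≤ y ⬝ᵥ y := Finset.sum_le_sum fun u _ => hrow u

lemma abs_eigenvalues_le {M : Matrix (Fin n) (Fin n) ℝ} (hM : M.IsHermitian) {c : ℝ}
    (h : ∀ y : Fin n → ℝ, |y ⬝ᵥ (M *ᵥ y)| ≤ c * (y ⬝ᵥ y)) (i : Fin n) :
    |hM.eigenvalues i| ≤ c := by
  set y : Fin n → ℝ := ⇑(hM.eigenvectorBasis i) with hy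
  have h1 : y ⬝ᵥ y = 1 := by
    have h2 := hM.eigenvectorBasis.orthonormal.1 i
    have h3 : ‖hM.eigenvectorBasis i‖ ^ 2 = 1 := by rw [h2, one_pow]
    rw [EuclideanSpace.norm_sq_eq] at h3
    rw [← h3]
    refine Finset.sum_congr rfl fun u _ => ?_
    rw [Real.norm_eq_abs, sq_abs, sq]
  have h4 := h y
  rw [hy, hM.mulVec_eigenvectorBasis, dotProduct_smul, ← hy, h1, mul_one, smul_eq_mul,
    mul_one] at h4
  exact h4

/-- Both quadratic forms are bounded by |y|², so the eigenvalues of the difference lie in [-2, 2].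
This makes s an admissible competitor in the moment-matching step. -/
lemma isCandidate_diffSpectralDensity [NeZero n] (G₁ G₂ : WeightedGraph n) :
    DiffSpectrum.IsCandidate (diffSpectralDensity G₁ G₂) := by
  refine ⟨isProbabilityMeasure_spectralDensity _, ?_⟩
  have hM := G₁.normalizedAdj_isHermitian.sub G₂.normalizedAdj_isHermitian
  have hev : ∀ i, hM.eigenvalues i ∈ Set.Icc (-2 : ℝ) 2 := by
    intro i
    refine abs_le.1 (abs_eigenvalues_le hM (c := 2) (fun y => ?_) i)
    rw [sub_mulVec, dotProduct_sub]
    refine (abs_sub _ _).trans ?_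
    linarith [abs_dotProduct_normalizedAdj_le G₁ y, abs_dotProduct_normalizedAdj_le G₂ y]
  simp only [diffSpectralDensity, spectralDensity, Measure.smul_apply, Measure.finsetSum_apply,
    smul_eq_mul]
  rw [Finset.sum_eq_zero, mul_zero]
  intro i _
  rw [Measure.dirac_apply' _ measurableSet_Icc.compl]
  simpa using hev i

/-- The transition matrix of the random walk. -/
noncomputable def transition (G : WeightedGraph n) : Matrix (Fin n) (Fin n) ℝ :=
  Matrix.of fun u v => (G.step u v).toReal

/-- At degree 0 the quotient is 0 by the convention for division, and the identity term records that
the walk stays put. -/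
lemma transition_apply (G : WeightedGraph n) (u v : Fin n) :
    transition G u v = G.adj u v / G.degree u +
      if G.degree u = 0 then (1 : Matrix (Fin n) (Fin n) ℝ) u v else 0 := by
  rw [transition, of_apply, WeightedGraph.step]
  rcases (G.degree_nonneg u).eq_or_lt with h | h
  · rw [dif_neg (by rw [← h]; exact lt_irrefl _), if_pos h.symm, ← h, div_zero, zero_add,
      PMF.pure_apply, one_apply]
    simp only [eq_comm (a := v)]
    split_ifs <;> simp
  · rw [dif_pos h, if_neg h.ne', add_zero, PMF.ofFintype_apply,
      ENNReal.toReal_ofReal (div_nonneg (G.nonneg u v) h.le)]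

/-- The identity terms at vertices of degree 0 cancel because the degrees agree. D⁻¹ = R * R holds
there as well, both sides being 0. -/
lemma transition_sub {G₁ G₂ : WeightedGraph n} (h : ∀ v, G₁.degree v = G₂.degree v) :
    transition G₁ - transition G₂
      = G₁.invSqrtDegree * (G₁.invSqrtDegree * (G₁.adj - G₂.adj)) := by
  ext u v
  simp only [Matrix.sub_apply, transition_apply, WeightedGraph.invSqrtDegree, diagonal_mul, ← h u]
  rw [← mul_assoc, ← mul_inv, Real.mul_self_sqrt (G₁.degree_nonneg u)]
  ring

lemma normalizedAdj_sub {G₁ G₂ : WeightedGraph n} (h : ∀ v, G₁.degree v = G₂.degree v) :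
    G₁.normalizedAdj - G₂.normalizedAdj
      = G₁.invSqrtDegree * (G₁.adj - G₂.adj) * G₁.invSqrtDegree := by
  have hR : G₂.invSqrtDegree = G₁.invSqrtDegree := by
    simp only [WeightedGraph.invSqrtDegree, h]
  rw [WeightedGraph.normalizedAdj, WeightedGraph.normalizedAdj, hR]
  noncomm_ring

lemma trace_mul_pow_comm (X Y : Matrix (Fin n) (Fin n) ℝ) (j : ℕ) :
    ((X * Y) ^ (j + 1)).trace = ((Y * X) ^ (j + 1)).trace := by
  rw [pow_succ, ← mul_assoc, mul_pow_mul, mul_assoc, trace_mul_comm, mul_assoc, ← pow_succ]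

/-- The two differences are R (R E) and (R E) R, with equal traces of powers by cyclicity.
Similarity is not used, as R is singular when there are vertices of degree 0. -/
lemma trace_transition_sub_pow {G₁ G₂ : WeightedGraph n} (h : ∀ v, G₁.degree v = G₂.degree v)
    (j : ℕ) : ((transition G₁ - transition G₂) ^ (j + 1)).trace
      = ((G₁.normalizedAdj - G₂.normalizedAdj) ^ (j + 1)).trace := by
  rw [transition_sub h, normalizedAdj_sub h, trace_mul_pow_comm]

/-- The product of the transition matrices along a pattern. -/
noncomputable def walkMatrix (G₁ G₂ : WeightedGraph n) :
    (j : ℕ) → (Fin j → Bool) → Matrix (Fin n) (Fin n) ℝ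
  | 0, _ => 1
  | j + 1, x => walkMatrix G₁ G₂ j (fun i => x i.castSucc) *
      transition (if x (Fin.last j) then G₁ else G₂)

/-- The noncommutative expansion of a power of a difference, by splitting off the last factor: each
choice of `true` or `false` selects T₁ or -T₂. -/
lemma sum_sign_smul_walkMatrix (G₁ G₂ : WeightedGraph n) (j : ℕ) :
    ∑ x : Fin j → Bool, DiffSpectrum.sign x • walkMatrix G₁ G₂ j x
      = (transition G₁ - transition G₂) ^ j := by
  induction j with
  | zero => simp [DiffSpectrum.sign, walkMatrix]
  | succ j ih =>
    rw [← (Fin.snocEquiv fun _ => Bool).sum_comp, Fintype.sum_prod_type, Fintype.sum_bool,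
      pow_succ, ← ih, mul_sub, Finset.sum_mul, Finset.sum_mul, sub_eq_add_neg,
      ← Finset.sum_neg_distrib]
    congr 1 <;> refine Finset.sum_congr rfl fun x _ => ?_
    all_goals
      simp [DiffSpectrum.sign, Fin.prod_univ_castSucc, walkMatrix, Fin.snocEquiv]

variable [NeZero n]

/-- The joint distribution of the first and the last vertex of a walk. -/
noncomputable def endpointLaw (G₁ G₂ : WeightedGraph n) (j : ℕ) (x : Fin j → Bool) : PMF (Fin n × Fin n) :=
  (walkOracle G₁ G₂ j x).map fun t => (t 0, t (Fin.last j))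

/-- The next step depends on the trajectory only through its last vertex, so the pair of endpoints
evolves as a Markov chain on its own. -/
lemma endpointLaw_succ (G₁ G₂ : WeightedGraph n) (j : ℕ) (x : Fin (j + 1) → Bool) :
    endpointLaw G₁ G₂ (j + 1) x
      = (endpointLaw G₁ G₂ j (fun i => x i.castSucc)).bind fun e =>
        ((if x (Fin.last j) then G₁ else G₂).step e.2).map fun v => (e.1, v) := by
  simp only [endpointLaw, walkOracle, PMF.map_bind, PMF.map_comp, PMF.bind_map]
  congr 1
  funext t
  simp only [Function.comp_def]
  congr 1
  funext v
  rw [Fin.snoc_last, ← Fin.castSucc_zero, Fin.snoc_castSucc]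

/-- The uniform start gives the factor 1/n, and each step multiplies by a transition matrix. The
start vertex never changes, so in the sum over previous pairs only those with first entry u count.
-/
lemma endpointLaw_apply (G₁ G₂ : WeightedGraph n) (j : ℕ) (x : Fin j → Bool) (u v : Fin n) :
    (endpointLaw G₁ G₂ j x (u, v)).toReal = (n : ℝ)⁻¹ * walkMatrix G₁ G₂ j x u v := by
  induction j generalizing v with
  | zero =>
    simp only [endpointLaw, walkOracle, PMF.map_comp, walkMatrix, one_apply]
    rw [PMF.map_apply, tsum_fintype, ENNReal.toReal_sum]
    · simp only [Function.comp_def, PMF.uniformOfFintype_apply, Fintype.card_fin,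
        Prod.mk.injEq]
      by_cases huv : u = v
      · subst huv
        rw [Finset.sum_eq_single u]
        · simp
        · intro b _ hb
          simp [hb.symm]
        · simp
      · rw [Finset.sum_eq_zero]
        · simp [huv]
        · intro b _
          rw [if_neg fun h => huv (h.1.trans h.2.symm), ENNReal.toReal_zero]
    · intro b _
      split_ifs
      · exact PMF.apply_ne_top _ _
      · exact ENNReal.zero_ne_top
  | succ j ih =>
    rw [endpointLaw_succ, PMF.bind_apply, tsum_fintype, Fintype.sum_prod_type,
      Finset.sum_eq_single u, ENNReal.toReal_sum, walkMatrix, mul_apply, Finset.mul_sum]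
    · refine Finset.sum_congr rfl fun b _ => ?_
      have hmap : (((if x (Fin.last j) then G₁ else G₂).step b).map fun v => (u, v)) (u, v)
          = (if x (Fin.last j) then G₁ else G₂).step b v := by
        rw [PMF.map_apply, tsum_eq_single v]
        · simp
        · intro w hw
          simp [hw.symm]
      rw [ENNReal.toReal_mul, ih, hmap, transition, of_apply, mul_assoc]
    · exact fun b _ => ENNReal.mul_ne_top (PMF.apply_ne_top _ _) (PMF.apply_ne_top _ _)
    · intro a _ ha
      refine Finset.sum_eq_zero fun b _ => ?_
      rw [PMF.map_apply, tsum_fintype, Finset.sum_eq_zero, mul_zero]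
      intro w _
      simp [ha.symm]
    · simp

/-- The probability that a walk returns to its starting vertex. -/
lemma integral_return (G₁ G₂ : WeightedGraph n) (j : ℕ) (x : Fin j → Bool) :
    ∫ t, (if t 0 = t (Fin.last j) then (1 : ℝ) else 0) ∂(walkOracle G₁ G₂ j x).toMeasure
      = (n : ℝ)⁻¹ * (walkMatrix G₁ G₂ j x).trace := by
  have hm : (walkOracle G₁ G₂ j x).toMeasure.map (fun t => (t 0, t (Fin.last j)))
      = (endpointLaw G₁ G₂ j x).toMeasure :=
    PMF.toMeasure_map _ _ (measurable_of_finite _)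
  have h : ∫ e, (if e.1 = e.2 then (1 : ℝ) else 0) ∂(endpointLaw G₁ G₂ j x).toMeasure
      = ∫ t, (if t 0 = t (Fin.last j) then (1 : ℝ) else 0)
        ∂(walkOracle G₁ G₂ j x).toMeasure := by
    rw [← hm, integral_map (measurable_of_finite _).aemeasurable
      (measurable_of_finite _).aestronglyMeasurable]
  rw [← h, PMF.integral_eq_sum, Fintype.sum_prod_type, trace, Finset.mul_sum]
  refine Finset.sum_congr rfl fun u _ => ?_
  rw [Finset.sum_eq_single u]
  · simp [endpointLaw_apply]
  · intro b _ hb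
    simp [hb.symm]
  · simp

/-- The moments of the spectral density are alternating sums of return probabilities. -/
theorem sum_sign_mul_integral_return {G₁ G₂ : WeightedGraph n}
    (h : ∀ v, G₁.degree v = G₂.degree v) (j : ℕ) :
    ∑ x : Fin (j + 1) → Bool, DiffSpectrum.sign x *
      ∫ t, (if t 0 = t (Fin.last (j + 1)) then (1 : ℝ) else 0)
        ∂(walkOracle G₁ G₂ (j + 1) x).toMeasure
      = rawMoment (diffSpectralDensity G₁ G₂) (j + 1) := by
  rw [diffSpectralDensity, rawMoment_spectralDensity, ← trace_transition_sub_pow h,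
    ← sum_sign_smul_walkMatrix, trace_sum, Finset.mul_sum]
  refine Finset.sum_congr rfl fun x _ => ?_
  rw [integral_return, trace_smul, smul_eq_mul]
  ring

end RandomWalkTrace

/-! ### Concentration of the moment estimates -/

namespace MomentConcentration

open DiffSpectrum ProbabilityTheory

lemma abs_sign {j : ℕ} (x : Fin j → Bool) : |DiffSpectrum.sign x| = 1 := by
  rw [DiffSpectrum.sign, Finset.abs_prod]
  refine Finset.prod_eq_one fun i _ => ?_
  split_ifs <;> simp

variable {n k : ℕ} {θ δ : ℝ}

/-- The indicator of a closed walk. -/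
noncomputable def returnIndicator (c : Call k θ δ) (t : Fin (c.length + 1) → Fin n) : ℝ :=
  if t 0 = t (Fin.last c.length) then 1 else 0

/-- The contribution of one call to the moment estimate, multiplied by `e`. -/
noncomputable def contribution (e : ℝ) (c : Call k θ δ) (t : Fin (c.length + 1) → Fin n) : ℝ :=
  e * (DiffSpectrum.sign c.pattern / numSamples k θ δ c.length) * returnIndicator c t

lemma sum_contribution (e : ℝ) (ω : Transcript n k θ δ) (j : Fin k) :
    ∑ y : (Fin (j + 1) → Bool) × Fin (numSamples k θ δ (j + 1)),
      contribution e (⟨j, y⟩ : Call k θ δ) (ω ⟨j, y⟩) = e * momentEstimate ω j := by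
  rw [momentEstimate, Fintype.sum_prod_type, Finset.mul_sum]
  refine Finset.sum_congr rfl fun x _ => ?_
  change ∑ i : Fin (numSamples k θ δ (j + 1)),
    e * (DiffSpectrum.sign x / numSamples k θ δ (j + 1)) *
      (if ω ⟨j, x, i⟩ 0 = ω ⟨j, x, i⟩ (Fin.last _) then (1 : ℝ) else 0) = _
  rw [← Finset.mul_sum, returnFraction, mul_assoc, div_mul_eq_mul_div, mul_div_assoc]

variable [NeZero n]

instance (G₁ G₂ : WeightedGraph n) : IsProbabilityMeasure (transcriptLaw G₁ G₂ k θ δ) := by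
  unfold transcriptLaw
  infer_instance

lemma integral_comp_coord (G₁ G₂ : WeightedGraph n) (c : Call k θ δ)
    (f : (Fin (c.length + 1) → Fin n) → ℝ) :
    ∫ ω, f (ω c) ∂(transcriptLaw G₁ G₂ k θ δ)
      = ∫ t, f t ∂(walkOracle G₁ G₂ c.length c.pattern).toMeasure := by
  have h := measurePreserving_eval
    (fun c : Call k θ δ => (walkOracle G₁ G₂ c.length c.pattern).toMeasure) c
  rw [← h.map_eq, integral_map h.measurable.aemeasurable
    (measurable_of_finite _).aestronglyMeasurable]
  rfl

/-- Hoeffding's lemma: the contribution takes values 0 and w with |w| = 1/N, where N is the number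
of samples, which gives variance proxy (1/(2N))². Taking e = 1 and e = -1 later covers the two
tails. -/
lemma hasSubgaussianMGF_contribution (G₁ G₂ : WeightedGraph n) {e : ℝ} (he : |e| = 1)
    (c : Call k θ δ) :
    HasSubgaussianMGF (fun ω => contribution e c (ω c)
      - ∫ t, contribution e c t ∂(walkOracle G₁ G₂ c.length c.pattern).toMeasure)
      ((((numSamples k θ δ c.length : NNReal))⁻¹ / 2) ^ 2) (transcriptLaw G₁ G₂ k θ δ) := by
  set w : ℝ := e * (DiffSpectrum.sign c.pattern / numSamples k θ δ c.length) with hw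
  have hmeas : Measurable fun ω : Transcript n k θ δ => contribution e c (ω c) :=
    (measurable_of_finite (contribution e c)).comp (measurable_pi_apply c)
  have h := hasSubgaussianMGF_of_mem_Icc (μ := transcriptLaw G₁ G₂ k θ δ) (a := min 0 w)
    (b := max 0 w) (X := fun ω => contribution e c (ω c)) hmeas.aemeasurable
    (Filter.Eventually.of_forall fun ω => by
      simp only [contribution, returnIndicator, ← hw]
      split_ifs <;> simp)
  rw [integral_comp_coord G₁ G₂ c (contribution e c)] at h
  have hnorm : ‖max 0 w - min 0 w‖₊ = ((numSamples k θ δ c.length : NNReal))⁻¹ := by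
    apply NNReal.coe_injective
    rw [coe_nnnorm, max_sub_min_eq_abs, Real.norm_eq_abs, abs_abs, sub_zero, hw, abs_mul, he,
      abs_div, abs_sign, Nat.abs_cast]
    simp
  rwa [hnorm] at h

/-- Unbiasedness: the N equal expectations for a pattern cancel the division by N, which requires N
≠ 0. -/
lemma sum_integral_contribution {G₁ G₂ : WeightedGraph n}
    (h : ∀ v, G₁.degree v = G₂.degree v) (e : ℝ) (j : Fin k)
    (hN : 0 < numSamples k θ δ (j + 1)) :
    ∑ y : (Fin (j + 1) → Bool) × Fin (numSamples k θ δ (j + 1)),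
      ∫ t, contribution e (⟨j, y⟩ : Call k θ δ) t
        ∂(walkOracle G₁ G₂ (Call.length (⟨j, y⟩ : Call k θ δ))
          (Call.pattern (⟨j, y⟩ : Call k θ δ))).toMeasure
      = e * rawMoment (diffSpectralDensity G₁ G₂) (j + 1) := by
  have hN' : (numSamples k θ δ (j + 1) : ℝ) ≠ 0 := by exact_mod_cast hN.ne'
  rw [← RandomWalkTrace.sum_sign_mul_integral_return h, Fintype.sum_prod_type, Finset.mul_sum]
  refine Finset.sum_congr rfl fun x _ => ?_
  simp only [contribution, returnIndicator]
  simp only [integral_const_mul]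
  change ∑ _i : Fin (numSamples k θ δ (j + 1)),
    e * (DiffSpectrum.sign x / numSamples k θ δ (j + 1)) *
      ∫ t, (if t 0 = t (Fin.last ((j : ℕ) + 1)) then (1 : ℝ) else 0)
        ∂(walkOracle G₁ G₂ ((j : ℕ) + 1) x).toMeasure = _
  rw [Finset.sum_const, Finset.card_univ, Fintype.card_fin, nsmul_eq_mul]
  field_simp

/-- Hoeffding's inequality applied at once to all 2^(j+1) * N calls of one length. The variance
proxies add up to 2^(j+1)/(4N). -/
lemma measureReal_le_exp {G₁ G₂ : WeightedGraph n} (h : ∀ v, G₁.degree v = G₂.degree v)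
    (hθ : 0 < θ) {e : ℝ} (he : |e| = 1) (j : Fin k) (hN : 0 < numSamples k θ δ (j + 1)) :
    (transcriptLaw G₁ G₂ k θ δ).real {ω | θ ≤ e * (momentEstimate ω j
        - rawMoment (diffSpectralDensity G₁ G₂) (j + 1))}
      ≤ Real.exp (-(2 * θ ^ 2 * numSamples k θ δ (j + 1) / 2 ^ ((j : ℕ) + 1))) := by
  have hN' : (numSamples k θ δ (j + 1) : ℝ) ≠ 0 := by exact_mod_cast hN.ne'
  have hind : iIndepFun (fun (c : Call k θ δ) (ω : Transcript n k θ δ) => contribution e c (ω c)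
      - ∫ t, contribution e c t ∂(walkOracle G₁ G₂ c.length c.pattern).toMeasure)
      (transcriptLaw G₁ G₂ k θ δ) :=
    iIndepFun_pi (μ := fun c : Call k θ δ => (walkOracle G₁ G₂ c.length c.pattern).toMeasure)
      (X := fun c t => contribution e c t
        - ∫ t, contribution e c t ∂(walkOracle G₁ G₂ c.length c.pattern).toMeasure)
      fun c => (measurable_of_finite _).aemeasurable
  have hinj : Function.Injective fun y : (Fin (j + 1) → Bool) × Fin (numSamples k θ δ (j + 1)) =>
      (⟨j, y⟩ : Call k θ δ) :=
    fun _ _ hy => eq_of_heq (Sigma.mk.inj hy).2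
  have hoeff := HasSubgaussianMGF.measure_sum_ge_le_of_iIndepFun (hind.precomp hinj)
    (s := Finset.univ)
    (c := fun _ => (((numSamples k θ δ (j + 1) : NNReal))⁻¹ / 2) ^ 2)
    (fun y _ => hasSubgaussianMGF_contribution G₁ G₂ he ⟨j, y⟩) hθ.le
  simp only [Finset.sum_sub_distrib] at hoeff
  have hset : {ω : Transcript n k θ δ | θ ≤ e * (momentEstimate ω j
        - rawMoment (diffSpectralDensity G₁ G₂) (j + 1))}
      = {ω | θ ≤ ∑ y : (Fin (j + 1) → Bool) × Fin (numSamples k θ δ (j + 1)),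
          contribution e (⟨j, y⟩ : Call k θ δ) (ω ⟨j, y⟩)
        - ∑ y : (Fin (j + 1) → Bool) × Fin (numSamples k θ δ (j + 1)),
          ∫ t, contribution e (⟨j, y⟩ : Call k θ δ) t
        ∂(walkOracle G₁ G₂ (Call.length (⟨j, y⟩ : Call k θ δ))
          (Call.pattern (⟨j, y⟩ : Call k θ δ))).toMeasure} := by
    ext ω
    simp only [Set.mem_ofPred_eq]
    rw [sum_contribution, sum_integral_contribution h e j hN, mul_sub]
  rw [hset]
  refine hoeff.trans (le_of_eq ?_)
  congr 1
  simp only [Finset.sum_const, Finset.card_univ, Fintype.card_prod, Fintype.card_fun,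
    Fintype.card_bool, Fintype.card_fin, nsmul_eq_mul]
  push_cast
  field_simp

/-- The sample size turns the exponent into at least (j+1) 2^(j+1) log(2k/δ), which is more than the
log(2k/δ) needed for a union bound over 2k tails. -/
lemma measureReal_le_div {G₁ G₂ : WeightedGraph n} (h : ∀ v, G₁.degree v = G₂.degree v)
    (hθ : 0 < θ) (hδ : 0 < δ) (hδk : δ < 2 * k) {e : ℝ} (he : |e| = 1) (j : Fin k) :
    (transcriptLaw G₁ G₂ k θ δ).real {ω | θ ≤ e * (momentEstimate ω j
        - rawMoment (diffSpectralDensity G₁ G₂) (j + 1))} ≤ δ / (2 * k) := by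
  have hk : (0 : ℝ) < 2 * k := hδ.trans hδk
  have hL : 0 < Real.log (2 * k / δ) := Real.log_pos ((one_lt_div hδ).2 hδk)
  set L := Real.log (2 * k / δ) with hLdef
  have hle : (1 / 2) * (θ ^ 2)⁻¹ * ((j : ℕ) + 1 : ℕ) * 4 ^ ((j : ℕ) + 1) * L
      ≤ numSamples k θ δ (j + 1) := Nat.le_ceil _
  have hNpos : 0 < numSamples k θ δ (j + 1) := by
    have : (0 : ℝ) < numSamples k θ δ (j + 1) := lt_of_lt_of_le (by positivity) hle
    exact_mod_cast this
  refine (measureReal_le_exp h hθ he j hNpos).trans ?_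
  have hexp : δ / (2 * k) = Real.exp (-L) := by
    rw [Real.exp_neg, hLdef, Real.exp_log (div_pos hk hδ), inv_div]
  rw [hexp, Real.exp_le_exp, neg_le_neg_iff, le_div_iff₀ (by positivity)]
  have h1 : 2 * θ ^ 2 * ((1 / 2) * (θ ^ 2)⁻¹ * ((j : ℕ) + 1 : ℕ) * 4 ^ ((j : ℕ) + 1) * L)
      = ((j : ℕ) + 1 : ℕ) * 4 ^ ((j : ℕ) + 1) * L := by
    field_simp
  have h2 := mul_le_mul_of_nonneg_left hle (show 0 ≤ 2 * θ ^ 2 by positivity)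
  rw [h1] at h2
  refine le_trans ?_ h2
  have h3 : (2 : ℝ) ^ ((j : ℕ) + 1) ≤ 4 ^ ((j : ℕ) + 1) :=
    pow_le_pow_left₀ (by norm_num) (by norm_num) _
  have h4 : (1 : ℝ) ≤ ((j : ℕ) + 1 : ℕ) := by exact_mod_cast Nat.succ_pos _
  rw [mul_comm L]
  refine mul_le_mul_of_nonneg_right ?_ hL.le
  nlinarith [show (0 : ℝ) < 4 ^ ((j : ℕ) + 1) by positivity]

/-- The moment estimates are accurate with probability at least `1 - δ`. -/
theorem measureReal_exists_inaccurate_le {G₁ G₂ : WeightedGraph n}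
    (h : ∀ v, G₁.degree v = G₂.degree v) (hθ : 0 < θ) (hδ : 0 < δ) (hδk : δ < 2 * k) :
    (transcriptLaw G₁ G₂ k θ δ).real {ω | ∀ j : Fin k, |momentEstimate ω j
        - rawMoment (diffSpectralDensity G₁ G₂) (j + 1)| ≤ θ}ᶜ ≤ δ := by
  have hk : (0 : ℝ) < k := by linarith
  set bad : ℝ → Fin k → Set (Transcript n k θ δ) := fun e j => {ω | θ ≤ e * (momentEstimate ω j
        - rawMoment (diffSpectralDensity G₁ G₂) (j + 1))} with hbad
  have hsub : {ω : Transcript n k θ δ | ∀ j : Fin k, |momentEstimate ω j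
        - rawMoment (diffSpectralDensity G₁ G₂) (j + 1)| ≤ θ}ᶜ
      ⊆ ⋃ j : Fin k, bad 1 j ∪ bad (-1) j := by
    intro ω hω
    simp only [Set.mem_compl_iff, Set.mem_ofPred_eq, not_forall, not_le] at hω
    obtain ⟨j, hj⟩ := hω
    refine Set.mem_iUnion.2 ⟨j, ?_⟩
    rcases lt_abs.1 hj with h' | h'
    · left
      simp only [hbad, Set.mem_ofPred_eq]
      linarith
    · right
      simp only [hbad, Set.mem_ofPred_eq]
      linarith
  calc _ ≤ (transcriptLaw G₁ G₂ k θ δ).real (⋃ j : Fin k, bad 1 j ∪ bad (-1) j) :=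
        measureReal_mono hsub
    _ ≤ ∑ j : Fin k, (transcriptLaw G₁ G₂ k θ δ).real (bad 1 j ∪ bad (-1) j) :=
        measureReal_iUnion_fintype_le _
    _ ≤ ∑ _j : Fin k, (δ / (2 * k) + δ / (2 * k)) :=
        Finset.sum_le_sum fun j _ => (measureReal_union_le _ _).trans (add_le_add
          (measureReal_le_div h hθ hδ hδk (by simp) j)
          (measureReal_le_div h hθ hδ hδk (by simp) j))
    _ = δ := by
        rw [Finset.sum_const, Finset.card_univ, Fintype.card_fin, nsmul_eq_mul]
        field_simp
        norm_num

end MomentConcentration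

/-! ### Moment matching and the choice of parameters -/

namespace DiffSpectrum

lemma isCandidate_dirac_zero : IsCandidate (Measure.dirac 0) := by
  refine ⟨Measure.dirac.isProbabilityMeasure, ?_⟩
  rw [Measure.dirac_apply' _ measurableSet_Icc.compl]
  simp

/-- The slack θ > 0 makes a near-minimiser sufficient, so attainment of the infimum need not be
shown. -/
lemma exists_isMomentMatch {k : ℕ} {θ : ℝ} (hθ : 0 < θ) (a : Fin k → ℝ) :
    ∃ p, IsMomentMatch θ a p := by
  set E : Set ℝ := momentError a '' {p | IsCandidate p} with hE
  have hne : E.Nonempty := ⟨_, _, isCandidate_dirac_zero, rfl⟩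
  have hbdd : BddBelow E := by
    refine ⟨0, ?_⟩
    rintro _ ⟨p, _, rfl⟩
    exact norm_nonneg _
  obtain ⟨_, ⟨p, hp, rfl⟩, hlt⟩ := exists_lt_of_csInf_lt hne (lt_add_of_pos_right (sInf E) hθ)
  exact ⟨p, hp, fun q hq => hlt.le.trans (by linarith [csInf_le hbdd ⟨q, hq, rfl⟩])⟩

/-- The competitor s has error at most θ, so p has error at most 2θ, and the triangle inequality
gives 3θ. The moment of order 0 is the total mass. -/
lemma abs_rawMoment_sub_le_of_isMomentMatch {k : ℕ} {θ : ℝ} (hθ : 0 < θ) {a : Fin k → ℝ}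
    {p s : Measure ℝ} (hs : IsCandidate s) (ha : ∀ j : Fin k, |a j - rawMoment s (j + 1)| ≤ θ)
    (hp : IsMomentMatch θ a p) : ∀ j ≤ k, |rawMoment p j - rawMoment s j| ≤ 3 * θ := by
  intro j hj
  have := hs.1
  have := hp.1.1
  rcases j with - | j
  · simp [rawMoment, hθ.le]
  · have h1 : momentError a s ≤ θ :=
      (pi_norm_le_iff_of_nonneg hθ.le).2 fun i => by
        rw [Real.norm_eq_abs, abs_sub_comm]
        exact ha i
    have h2 : momentError a p ≤ 2 * θ := by linarith [hp.2 s hs]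
    have h3 := (norm_le_pi_norm (fun i : Fin k => rawMoment p (i + 1) - a i)
      ⟨j, by omega⟩).trans h2
    have h4 := ha ⟨j, by omega⟩
    rw [Real.norm_eq_abs] at h3
    rw [abs_le] at h3 h4 ⊢
    constructor <;> linarith [h3.1, h3.2, h4.1, h4.2]

lemma card_call (k : ℕ) (θ δ : ℝ) : Fintype.card (Call k θ δ)
    = ∑ j : Fin k, 2 ^ ((j : ℕ) + 1) * numSamples k θ δ (j + 1) := by
  simp [Call, Fintype.card_sigma]

/-- Here θ⁻² = ε⁻² * 81 * 81^k with ε⁻¹ ≤ k, and log(20k) ≤ 20k. Then 324 = 81 * 4, 810 = (1/2) * 81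
* 20, and the ceiling costs one more. -/
lemma numSamples_le {k j : ℕ} {ε θ : ℝ} (hj : j ≤ k) (hε : 0 < ε) (hk : 1 ≤ k)
    (hεk : 1 / ε ≤ k) (hθ : θ = ε / 3 ^ (2 * k + 2)) :
    (numSamples k θ (1 / 10) j : ℝ) ≤ 811 * k ^ 4 * 324 ^ k := by
  have hk1 : (1 : ℝ) ≤ k := by exact_mod_cast hk
  have hlog : Real.log (2 * k / (1 / 10)) ≤ 20 * k := by
    refine (Real.log_le_self (by positivity)).trans (le_of_eq ?_)
    ring
  have hlog0 : 0 ≤ Real.log (2 * k / (1 / 10)) := Real.log_nonneg (by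
    rw [le_div_iff₀ (by norm_num)]
    linarith)
  have hθi : (θ ^ 2)⁻¹ ≤ k ^ 2 * (81 * 81 ^ k) := by
    have h1 : (θ ^ 2)⁻¹ = (1 / ε) ^ 2 * (81 * 81 ^ k) := by
      rw [hθ, div_pow, inv_div, ← pow_mul, show (2 * k + 2) * 2 = 4 * (k + 1) by ring, pow_mul,
        show (3 : ℝ) ^ 4 = 81 by norm_num, pow_succ']
      field_simp
    rw [h1]
    have : 0 ≤ 1 / ε := by positivity
    gcongr
  have hj' : (j : ℝ) ≤ k := by exact_mod_cast hj
  have h4 : (4 : ℝ) ^ j ≤ 4 ^ k := pow_le_pow_right₀ (by norm_num) hj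
  have hmain : (1 / 2) * (θ ^ 2)⁻¹ * j * 4 ^ j * Real.log (2 * k / (1 / 10))
      ≤ 810 * k ^ 4 * 324 ^ k := by
    calc _ ≤ (1 / 2) * ((k : ℝ) ^ 2 * (81 * 81 ^ k)) * k * 4 ^ k * (20 * k) := by
          gcongr
      _ = 810 * k ^ 4 * 324 ^ k := by
          rw [show (324 : ℝ) = 81 * 4 by norm_num, mul_pow]
          ring
  have hceil := Nat.ceil_lt_add_one (a := (1 / 2) * (θ ^ 2)⁻¹ * j * 4 ^ j *
    Real.log (2 * k / (1 / 10))) (by positivity)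
  have h1 : (1 : ℝ) ≤ k ^ 4 * 324 ^ k :=
    one_le_mul_of_one_le_of_one_le (one_le_pow₀ hk1) (one_le_pow₀ (by norm_num))
  rw [numSamples]
  linarith

lemma card_call_le {k : ℕ} {ε θ : ℝ} (hε : 0 < ε) (hk : 1 ≤ k) (hεk : 1 / ε ≤ k)
    (hθ : θ = ε / 3 ^ (2 * k + 2)) :
    (Fintype.card (Call k θ (1 / 10)) : ℝ) ≤ 2 ^ (25 * k) := by
  have hk2 : (k : ℝ) ≤ 2 ^ k := by exact_mod_cast Nat.lt_two_pow_self.le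
  have h811 : (811 : ℝ) ≤ (2 ^ 10) ^ k :=
    (by norm_num : (811 : ℝ) ≤ 2 ^ 10).trans (le_self_pow₀ (by norm_num) (by omega))
  rw [card_call]
  push_cast
  calc ∑ j : Fin k, (2 : ℝ) ^ ((j : ℕ) + 1) * numSamples k θ (1 / 10) (j + 1)
      ≤ ∑ _j : Fin k, (2 : ℝ) ^ k * (811 * k ^ 4 * 324 ^ k) := by
        refine Finset.sum_le_sum fun j _ => ?_
        exact mul_le_mul (pow_le_pow_right₀ (by norm_num) j.2)
          (numSamples_le j.2 hε hk hεk hθ) (Nat.cast_nonneg _) (by positivity)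
    _ = 811 * (k : ℝ) ^ 5 * (2 ^ k * 324 ^ k) := by
        rw [Finset.sum_const, Finset.card_univ, Fintype.card_fin, nsmul_eq_mul]
        ring
    -- Each factor is bounded by a power of 2^k, and the exponents 10, 5, 1 and 9 add up to 25.
    _ ≤ (2 ^ 10) ^ k * (2 ^ k) ^ 5 * (2 ^ k * (2 ^ 9) ^ k) := by
        gcongr
        norm_num
    _ = 2 ^ (25 * k) := by
        simp only [← pow_mul, ← pow_add]
        congr 1
        omega

/-- Each term is at most ε/2. The first is at most 30/k, and kε ≥ 400. The second uses k² 2^k ≤ 8^k,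
with the constant absorbed by (9/8)^k through Bernoulli's inequality. -/
lemma approximation_error_le {k : ℕ} {C ε θ : ℝ} (hC : 100 ≤ C) (hε : 0 < ε) (hε1 : ε < 1)
    (hk : 4 * C / ε ≤ k) (hθ : θ = ε / 3 ^ (2 * k + 2)) :
    6 / ((k / 4 : ℕ) : ℝ) + 4 * (k : ℝ) ^ 2 * 2 ^ k * (3 * θ) ≤ ε := by
  have hk400 : 400 ≤ k * ε := by
    rw [div_le_iff₀ hε] at hk
    linarith
  have hkR : (400 : ℝ) ≤ k := by nlinarith [Nat.cast_nonneg (α := ℝ) k]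
  have hkN : 400 ≤ k := by exact_mod_cast hkR
  have h1 : 6 / ((k / 4 : ℕ) : ℝ) ≤ ε / 2 := by
    have hq : (k : ℝ) ≤ 5 * ((k / 4 : ℕ) : ℝ) := by
      have : k ≤ 5 * (k / 4) := by omega
      exact_mod_cast this
    rw [div_le_iff₀ (by linarith)]
    nlinarith
  have h2 : 4 * (k : ℝ) ^ 2 * 2 ^ k * (3 * θ) ≤ ε / 2 := by
    have hk2 : (k : ℝ) ≤ 2 ^ k := by exact_mod_cast Nat.lt_two_pow_self.le
    have hbern := one_add_mul_le_pow (show (-2 : ℝ) ≤ 1 / 8 by norm_num) k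
    have h98 : (8 : ℝ) / 3 ≤ (1 + 1 / 8) ^ k := by linarith
    have h9 : (9 : ℝ) ^ k = 8 ^ k * (1 + 1 / 8) ^ k := by
      rw [← mul_pow]
      norm_num
    have h24 : 24 * (k : ℝ) ^ 2 * 2 ^ k ≤ 3 ^ (2 * k + 2) := by
      calc 24 * (k : ℝ) ^ 2 * 2 ^ k ≤ 24 * (2 ^ k) ^ 2 * 2 ^ k := by gcongr
        _ = 9 * (8 ^ k * (8 / 3)) := by
            rw [show (8 : ℝ) = 2 ^ 3 by norm_num, ← pow_mul, ← pow_mul]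
            ring
        _ ≤ 9 * (8 ^ k * (1 + 1 / 8) ^ k) := by gcongr
        _ = 3 ^ (2 * k + 2) := by
            rw [← h9, pow_add, pow_mul]
            norm_num
            ring
    rw [hθ]
    have hpos : (0 : ℝ) < 3 ^ (2 * k + 2) := by positivity
    calc 4 * (k : ℝ) ^ 2 * 2 ^ k * (3 * (ε / 3 ^ (2 * k + 2)))
        = (24 * (k : ℝ) ^ 2 * 2 ^ k) / 3 ^ (2 * k + 2) * (ε / 2) := by
          field_simp
          norm_num
      _ ≤ 1 * (ε / 2) := by
          refine mul_le_mul_of_nonneg_right ?_ (by linarith)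
          rwa [div_le_one hpos]
      _ = ε / 2 := one_mul _
  linarith

end DiffSpectrum

/-! ### Assembly of the theorem -/

theorem mainTheorem6 :
    ∃ C₀ : ℝ, 0 < C₀ ∧ ∀ C : ℝ, C₀ ≤ C → ∃ K : ℝ, 0 < K ∧
      ∀ ε : ℝ, 0 < ε → ε < 1 →
      ∀ (k : ℕ) (θ δ : ℝ), k = ⌈4 * C / ε⌉₊ → θ = ε / 3 ^ (2 * k + 2) → δ = 1 / 10 →
        -- the number of oracle calls and the lengths of the walks
        (Fintype.card (DiffSpectrum.Call k θ δ) : ℝ) ≤ (2 : ℝ) ^ (K / ε) ∧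
        (∀ c : DiffSpectrum.Call k θ δ, (c.length : ℝ) ≤ K / ε) ∧
        ∀ (n : ℕ) [NeZero n] (G₁ G₂ : WeightedGraph n), (∀ v, G₁.degree v = G₂.degree v) →
          -- the algorithm always has an output
          (∀ ω : DiffSpectrum.Transcript n k θ δ,
            ∃ p, DiffSpectrum.IsMomentMatch θ (DiffSpectrum.momentEstimate ω) p) ∧
          -- with probability at least 0.9, the moment estimates are accurate and every possible
          -- output is close to the spectral density
          ENNReal.ofReal 0.9 ≤ DiffSpectrum.transcriptLaw G₁ G₂ k θ δ
            {ω | (∀ j : Fin k, |DiffSpectrum.momentEstimate ω j -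
                    rawMoment (diffSpectralDensity G₁ G₂) (j + 1)| ≤ θ) ∧
                 ∀ p, DiffSpectrum.IsMomentMatch θ (DiffSpectrum.momentEstimate ω) p →
                   wasserstein1 p (diffSpectralDensity G₁ G₂) ≤ ENNReal.ofReal ε} := by
  -- C ≥ 100 yields kε ≥ 400, as the error bound requires. Since ε < 1, rounding up gives k ≤ (4C +
  -- 1)/ε, and the number of calls is at most 2^(25k).
  refine ⟨100, by norm_num, fun C hC => ⟨25 * (4 * C + 1), by linarith, ?_⟩⟩
  intro ε hε hε1 k θ δ hk hθ hδ
  have hθpos : 0 < θ := by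
    rw [hθ]
    positivity
  have hkge : 4 * C / ε ≤ k := by
    rw [hk]
    exact Nat.le_ceil _
  have hkle : (k : ℝ) ≤ (4 * C + 1) / ε := by
    have h1 := Nat.ceil_lt_add_one (a := 4 * C / ε) (by positivity)
    rw [← hk] at h1
    have h2 : 1 ≤ 1 / ε := by
      rw [le_div_iff₀ hε]
      linarith
    rw [add_div]
    linarith
  have hεk : 1 / ε ≤ k := by
    refine le_trans ?_ hkge
    gcongr
    linarith
  have hk400 : (400 : ℝ) ≤ k := by
    rw [div_le_iff₀ hε] at hkge
    nlinarith [Nat.cast_nonneg (α := ℝ) k]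
  have hkN : 400 ≤ k := by exact_mod_cast hk400
  have hK : 25 * (k : ℝ) ≤ 25 * (4 * C + 1) / ε := by
    rw [mul_div_assoc]
    linarith
  refine ⟨?_, ?_, ?_⟩
  · rw [hδ]
    refine (DiffSpectrum.card_call_le hε (by omega) hεk hθ).trans ?_
    rw [← Real.rpow_natCast]
    refine Real.rpow_le_rpow_of_exponent_le (by norm_num) ?_
    push_cast
    exact hK
  · intro c
    have : (c.length : ℝ) ≤ k := by exact_mod_cast c.1.2
    linarith
  · intro n _ G₁ G₂ hdeg
    refine ⟨fun ω => DiffSpectrum.exists_isMomentMatch hθpos _, ?_⟩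
    have hs := RandomWalkTrace.isCandidate_diffSpectralDensity G₁ G₂
    set good : Set (DiffSpectrum.Transcript n k θ δ) :=
      {ω | ∀ j : Fin k, |DiffSpectrum.momentEstimate ω j -
        rawMoment (diffSpectralDensity G₁ G₂) (j + 1)| ≤ θ} with hgood
    have hbad : (DiffSpectrum.transcriptLaw G₁ G₂ k θ δ).real goodᶜ ≤ 1 / 10 := by
      rw [← hδ]
      refine MomentConcentration.measureReal_exists_inaccurate_le hdeg hθpos ?_ ?_
      · rw [hδ]
        norm_num
      · rw [hδ]
        linarith
    have hgoodprob : ENNReal.ofReal 0.9 ≤ DiffSpectrum.transcriptLaw G₁ G₂ k θ δ good := by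
      have h1 := measureReal_union_le (μ := DiffSpectrum.transcriptLaw G₁ G₂ k θ δ) good goodᶜ
      rw [Set.union_compl_self, probReal_univ] at h1
      rw [ENNReal.ofReal_le_iff_le_toReal (measure_ne_top _ _), ← measureReal_def]
      linarith
    -- Once the estimates are accurate, the rest is deterministic and holds for all outputs p at
    -- once. The choice q = k / 4 is the largest allowed by the degree bound 4q ≤ k.
    refine hgoodprob.trans (measure_mono fun ω hω => ⟨hω, fun p hp => ?_⟩)
    refine (RealTransport.wasserstein1_le_of_moments hp.1 hs
      (DiffSpectrum.abs_rawMoment_sub_le_of_isMomentMatch hθpos hs hω hp) (q := k / 4)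
      (by omega) (by omega)).trans (ENNReal.ofReal_le_ofReal ?_)
    exact DiffSpectrum.approximation_error_le hC hε hε1 hkge hθ
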